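/- **Theorem 1.6.** Let $n\ge 2$, $0<s<1$ and $M>0$. There is a constant $\alpha>0$, depending only on $n$, $s$ and $M$, with the following property. Let $x_0\in\mathbb R^n$, $0<r\le 1$, and let $B_\rho=B_\rho(x_0)$ denote the open ball of radius $\rho$ about $x_0$. Let $\vec b\in C^1(B_r;\mathbb R^n)$ satisfy $\|\vec b\|_{C^1(B_r)}=\sup_{B_r}|\vec b|+\sup_{B_r}|D\vec b|\le M$, let $c:B_r\to\mathbb R$ satisfy $c\le M$ a.e. in $B_r$, and let $u:\mathbb R^n\to\mathbb R$ be measurable with $$u\in\mathcal L_{2s},\quad\text{i.e.}\quad \int_{\mathbb R^n}\frac{|u(y)|}{1+|y|^{n+2s}}\,dy<\infty,\qquad u\ge 0\ \text{ a.e. in }\mathbb R^n,\qquad cu\in L^1_{\rm loc}(B_r).$$ Suppose that $$(-\Delta)^s u+\vec b\cdot\nabla u+cu\ \ge\ 0\quad\text{in }\mathcal D'(B_r),$$ that is, for every $\varphi\in C_c^\infty(B_r)$ with $\varphi\ge 0$, $$\int_{\mathbb R^n}u\,(-\Delta)^s\varphi\,dx-\int_{B_r}u\,\operatorname{div}(\varphi\,\vec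 b)\,dx+\int_{B_r}c\,u\,\varphi\,dx\ \ge\ 0,$$ where $(-\Delta)^s\varphi(x)=C_{n,s}\,\lim_{\varepsilon\to0^+}\int_{|x-y|>\varepsilon}\frac{\varphi(x)-\varphi(y)}{|x-y|^{n+2s}}\,dy$ and $C_{n,s}=\frac{s\,4^s\,\Gamma(n/2+s)}{\pi^{n/2}\,\Gamma(1-s)}$. If $m>0$ and $u\ge m$ a.e. in $B_r\setminus B_{r/2}$, then $$u\ge\alpha m\quad\text{a.e. in }B_r .$$ -/

import Mathlib

open MeasureTheory Filter Topology

noncomputable section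

namespace FracMaxPrinciple

/-- Euclidean space `ℝⁿ`. -/
abbrev E (n : ℕ) : Type := EuclideanSpace ℝ (Fin n)

/-- The weighted space `𝓛_a`: (measurable) functions `u` on `ℝⁿ` with
`∫ |u(y)| / (1 + |y|^{n+a}) dy < ∞`. -/
def MemL {n : ℕ} (a : ℝ) (u : E n → ℝ) : Prop :=
  Integrable (fun y : E n => u y / (1 + ‖y‖ ^ ((n : ℝ) + a))) volume

/-- The normalizing constant
`C_{n,s} = 4^s Γ(n/2 + s) / (π^{n/2} |Γ(-s)|) = s 4^s Γ(n/2 + s) / (π^{n/2} Γ(1 - s))`. -/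
def fracConst (n : ℕ) (s : ℝ) : ℝ :=
  s * (4 : ℝ) ^ s * Real.Gamma ((n : ℝ) / 2 + s) /
    (Real.pi ^ ((n : ℝ) / 2) * Real.Gamma (1 - s))

/-- The fractional Laplacian
`(-Δ)^s φ(x) = C_{n,s} P.V. ∫ (φ(x) - φ(y)) / |x - y|^{n+2s} dy`, where the principal value is the
limit as `ε → 0+` of the integrals over `|x - y| > ε`. It is only applied to smooth compactly
supported functions, for which the limit exists. -/
def fracLaplacian {n : ℕ} (s : ℝ) (φ : E n → ℝ) (x : E n) : ℝ :=
  fracConst n s * limUnder (𝓝[>] (0 : ℝ)) (fun ε : ℝ =>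
    ∫ y in (Metric.closedBall x ε)ᶜ, (φ x - φ y) / ‖x - y‖ ^ ((n : ℝ) + 2 * s))

/-- The divergence `∑ᵢ ∂ᵢ Fᵢ` of a vector field. -/
def divergence {n : ℕ} (F : E n → E n) (x : E n) : ℝ :=
  ∑ i : Fin n, fderiv ℝ (fun y => F y i) x (EuclideanSpace.single i 1)

/-- The `C¹(Ω)` norm `sup_Ω |b| + sup_Ω |Db|` of a vector field, with values in `[0, ∞]`. -/
def c1Norm {n : ℕ} (b : E n → E n) (Ω : Set (E n)) : ENNReal :=
  (⨆ x ∈ Ω, ‖b x‖ₑ) + ⨆ x ∈ Ω, ‖fderiv ℝ b x‖ₑ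

/-- The value at the test function `φ` of the distribution `(-Δ)^s u + b · ∇u + c u`, that is
`∫ u (-Δ)^s φ - ∫ u div(φ b) + ∫ c u φ`. -/
def pairing {n : ℕ} {Ω : TopologicalSpace.Opens (E n)} (s : ℝ) (b : E n → E n) (c u : E n → ℝ)
    (φ : TestFunction Ω ℝ ⊤) : ℝ :=
  (∫ x, u x * fracLaplacian s φ x)
    - (∫ x in (Ω : Set (E n)), u x * divergence (fun y => φ y • b y) x)
    + ∫ x in (Ω : Set (E n)), c x * u x * φ x

/-- `(-Δ)^s u + b · ∇u + c u ≥ 0` in `𝓓'(Ω)`. -/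
def IsSupersolution {n : ℕ} (s : ℝ) (b : E n → E n) (c u : E n → ℝ)
    (Ω : TopologicalSpace.Opens (E n)) : Prop :=
  ∀ φ : TestFunction Ω ℝ ⊤, (∀ x, 0 ≤ φ x) → 0 ≤ pairing s b c u φ

/-- The open ball `B_r(x₀)` as an open set. -/
def openBall {n : ℕ} (x₀ : E n) (r : ℝ) : TopologicalSpace.Opens (E n) :=
  ⟨Metric.ball x₀ r, Metric.isOpen_ball⟩

end FracMaxPrinciple

end


/-!
Cut `u` off at a level `k = α m` inside a ball `B_{R₃}` slightly smaller than `B_r`, that is, put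
`v = 1_{B_{R₃}} (u - k)`. Against a test function `Φ ≥ 0` supported in a smaller ball, discarding
the values `u ≥ m` on the annulus `B_r ∖ B_{R₃}` gains at least
`C_{n,s} m |B_r ∖ B_{R₃}| (2r)^{-n-2s} ∫ Φ`, whereas subtracting `k` costs at most a fixed multiple
of `k ∫ Φ`. Hence for small `α` the function `v` is again a supersolution, with `c` replaced by a
large constant `N`. Moreover `v` is integrable, `v ≥ -k`, and `v ≥ 0` off a compact subset of the
ball in which it is tested.

Such a `v` is nonnegative. Test its inequality with `ρ ⋆ (ρ ⋆ v)⁻` for an even mollifier `ρ` at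
scale `ε`. The fractional energy of `w = ρ ⋆ v` against `w⁻` has a sign, and the drift contributes
`½ ∫ (w⁻)² div b`, which `N` absorbs, plus a DiPerna–Lions commutator. The commutator kernel has
size `C / |B_ε|`, is supported in `|x - y| < ε` and has zero integral in `y`, so that the commutator
is controlled by the `L¹` modulus of continuity of `v` under translations and disappears as `ε → 0`.
-/

noncomputable section

namespace FracMaxPrinciple

section Kernel

variable {F : Type*} [NormedAddCommGroup F] [NormedSpace ℝ F] [FiniteDimensional ℝ F]
  [MeasureSpace F] [BorelSpace F] [(volume : Measure F).IsAddHaarMeasure] {p : ℝ}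

theorem integrable_min_one_sq_div_rpow (hp : Module.finrank ℝ F < p)
    (hp' : p < Module.finrank ℝ F + 2) :
    Integrable (fun z : F => min 1 (‖z‖ ^ 2) / ‖z‖ ^ p) := by
  rcases subsingleton_or_nontrivial F with hF | hF
  · have hzero : (fun z : F => min 1 (‖z‖ ^ 2) / ‖z‖ ^ p) = 0 := by
      ext z
      simp [Subsingleton.elim z 0]
    exact hzero ▸ integrable_zero F ℝ volume
  refine (integrable_fun_norm_addHaar volume (f := fun t : ℝ => min 1 (t ^ 2) / t ^ p)).2 ?_
  set d := Module.finrank ℝ F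
  have hd : 1 ≤ d := Module.finrank_pos
  have radial : ∀ t : ℝ, 0 < t → t ^ (d - 1) • (min 1 (t ^ 2) / t ^ p)
      = min 1 (t ^ 2) * t ^ (d - 1 - p) := by
    intro t ht
    rw [smul_eq_mul, ← Real.rpow_natCast t (d - 1), Nat.cast_sub hd, mul_div_left_comm,
      ← Real.rpow_sub ht, Nat.cast_one]
  rw [← Set.Ioc_union_Ioi_eq_Ioi (zero_le_one (α := ℝ))]
  refine IntegrableOn.union ?_ ?_
  · have near : IntegrableOn (fun t : ℝ => t ^ (d + 1 - p)) (Set.Ioc 0 1) := by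
      rw [← intervalIntegrable_iff_integrableOn_Ioc_of_le zero_le_one]
      exact intervalIntegral.intervalIntegrable_rpow' (by linarith)
    refine near.congr_fun (fun t ht => ?_) measurableSet_Ioc
    beta_reduce
    rw [radial t ht.1, min_eq_right (pow_le_one₀ ht.1.le ht.2), ← Real.rpow_natCast t 2,
      ← Real.rpow_add ht.1]
    congr 1
    push_cast
    ring
  · have far : IntegrableOn (fun t : ℝ => t ^ (d - 1 - p)) (Set.Ioi 1) :=
      integrableOn_Ioi_rpow_of_lt (by linarith) one_pos
    refine far.congr_fun (fun t (ht : 1 < t) => ?_) measurableSet_Ioi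
    beta_reduce
    rw [radial t (by linarith), min_eq_left (one_le_pow₀ ht.le), one_mul]

theorem integrableOn_one_div_rpow_compl_closedBall (hp : Module.finrank ℝ F < p) {ε : ℝ}
    (hε : 0 < ε) :
    IntegrableOn (fun z : F => 1 / ‖z‖ ^ p) (Metric.closedBall 0 ε)ᶜ := by
  have hp0 : 0 ≤ p := (Nat.cast_nonneg _).trans hp.le
  refine Integrable.mono' ((integrable_one_add_norm hp).const_mul ((1 + ε⁻¹) ^ p)).integrableOn
    (Measurable.aestronglyMeasurable (by fun_prop))
    ((ae_restrict_iff' Metric.isClosed_closedBall.measurableSet.compl).2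
      (Eventually.of_forall fun z hz => ?_))
  have hz' : ε < ‖z‖ := by simpa using hz
  have hz0 : 0 < ‖z‖ := hε.trans hz'
  have hle : 1 + ‖z‖ ≤ (1 + ε⁻¹) * ‖z‖ := by
    have := mul_le_mul_of_nonneg_left hz'.le (inv_nonneg.2 hε.le)
    rw [inv_mul_cancel₀ hε.ne'] at this
    linarith
  rw [Real.norm_of_nonneg (by positivity), Real.rpow_neg (by positivity), ← div_eq_mul_inv,
    div_le_div_iff₀ (by positivity) (by positivity), one_mul,
    ← Real.mul_rpow (by positivity) hz0.le]
  gcongr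

end Kernel

theorem tendsto_setIntegral_compl_closedBall {X G : Type*} [MetricSpace X] [MeasurableSpace X]
    [BorelSpace X] {μ : Measure X} [NormedAddCommGroup G] [NormedSpace ℝ G] {f : X → G}
    (hf : Integrable f μ) {a : X} (ha : f a = 0) :
    Tendsto (fun ε : ℝ => ∫ z in (Metric.closedBall a ε)ᶜ, f z ∂μ) (𝓝[>] 0)
      (𝓝 (∫ z, f z ∂μ)) := by
  have hms : ∀ ε : ℝ, MeasurableSet (Metric.closedBall a ε)ᶜ := fun ε =>
    Metric.isClosed_closedBall.measurableSet.compl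
  simp_rw [← fun ε => integral_indicator (f := f) (μ := μ) (hms ε)]
  refine tendsto_integral_filter_of_dominated_convergence _ (Eventually.of_forall fun ε =>
    hf.aestronglyMeasurable.indicator (hms ε)) (Eventually.of_forall fun ε =>
    Eventually.of_forall fun z => norm_indicator_le_norm_self _ _) hf.norm
    (Eventually.of_forall fun z => ?_)
  rcases eq_or_ne z a with rfl | hz
  · simp [Set.indicator, ha]
  · refine tendsto_const_nhds.congr' ?_
    have hsmall : ∀ᶠ ε : ℝ in 𝓝[>] (0 : ℝ), ε < dist z a :=
      (eventually_lt_nhds (dist_pos.2 hz)).filter_mono nhdsWithin_le_nhds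
    filter_upwards [hsmall] with ε hε
    rw [Set.indicator_of_mem (by simpa using hε)]

section SecondDiff

variable {F : Type*} [NormedAddCommGroup F]

/-- The symmetric second difference of a function, the integrand in the absolutely convergent form
of the fractional Laplacian. -/
def secondDiff (φ : F → ℝ) (x z : F) : ℝ := 2 * φ x - φ (x + z) - φ (x - z)

theorem continuous_uncurry_secondDiff {φ : F → ℝ} (hφ : Continuous φ) :
    Continuous (fun q : F × F => secondDiff φ q.1 q.2) := by
  unfold secondDiff
  fun_prop

variable [NormedSpace ℝ F]

theorem abs_sub_sub_fderiv_le {φ : F → ℝ} {L : NNReal} (hφ : Differentiable ℝ φ)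
    (hL : LipschitzWith L (fderiv ℝ φ)) (x z : F) :
    |φ (x + z) - φ x - fderiv ℝ φ x z| ≤ L * ‖z‖ ^ 2 := by
  have hbound : ∀ y ∈ segment ℝ x (x + z), ‖fderiv ℝ φ y - fderiv ℝ φ x‖ ≤ L * ‖z‖ := by
    intro y hy
    refine (hL.norm_sub_le y x).trans ?_
    rw [segment_eq_image'] at hy
    obtain ⟨t, ht, rfl⟩ := hy
    simp only [add_sub_cancel_left, norm_smul, Real.norm_eq_abs, abs_of_nonneg ht.1]
    gcongr
    exact mul_le_of_le_one_left (norm_nonneg z) ht.2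
  simpa [Real.norm_eq_abs, pow_two, mul_assoc] using
    (convex_segment x (x + z)).norm_image_sub_le_of_norm_fderiv_le' (𝕜 := ℝ)
      (fun y _ => hφ y) hbound (left_mem_segment ℝ _ _) (right_mem_segment ℝ _ _)

theorem exists_abs_secondDiff_le [FiniteDimensional ℝ F] {φ : F → ℝ} (hφ : ContDiff ℝ 2 φ)
    (hc : HasCompactSupport φ) :
    ∃ K : ℝ, ∀ x z, |secondDiff φ x z| ≤ K * min 1 (‖z‖ ^ 2) := by
  have hfderiv : ContDiff ℝ 1 (fderiv ℝ φ) := hφ.fderiv_right (by norm_num)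
  obtain ⟨L, hL⟩ := hfderiv.lipschitzWith_of_hasCompactSupport (hc.fderiv ℝ) one_ne_zero
  obtain ⟨A, hA⟩ := hφ.continuous.bounded_above_of_compact_support hc
  simp only [Real.norm_eq_abs, abs_le] at hA
  refine ⟨max (4 * A) (2 * L), fun x z => ?_⟩
  have far : |secondDiff φ x z| ≤ 4 * A := by
    rw [secondDiff, abs_le]
    constructor <;> linarith [(hA x).1, (hA x).2, (hA (x + z)).1, (hA (x + z)).2,
      (hA (x - z)).1, (hA (x - z)).2]
  have near : |secondDiff φ x z| ≤ 2 * L * ‖z‖ ^ 2 := by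
    have taylor := abs_sub_sub_fderiv_le (hφ.differentiable two_ne_zero) hL x
    have hplus := abs_le.1 (taylor z)
    have hminus := abs_le.1 (taylor (-z))
    rw [norm_neg, map_neg, ← sub_eq_add_neg] at hminus
    rw [secondDiff, abs_le]
    constructor <;> linarith [hplus.1, hplus.2, hminus.1, hminus.2]
  rcases le_total 1 (‖z‖ ^ 2) with h | h
  · rw [min_eq_left h, mul_one]
    exact far.trans (le_max_left _ _)
  · rw [min_eq_right h]
    exact near.trans (by gcongr; exact le_max_right _ _)

variable [FiniteDimensional ℝ F] [MeasureSpace F] [BorelSpace F]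
  [(volume : Measure F).IsAddHaarMeasure] {p : ℝ}

theorem integrable_mul_secondDiff_div_rpow (hp : Module.finrank ℝ F < p)
    (hp' : p < Module.finrank ℝ F + 2) {φ w : F → ℝ} (hφ : ContDiff ℝ 2 φ)
    (hc : HasCompactSupport φ) (hw : Integrable w) :
    Integrable (fun q : F × F => w q.1 * (secondDiff φ q.1 q.2 / ‖q.2‖ ^ p)) := by
  obtain ⟨K, hK⟩ := exists_abs_secondDiff_le hφ hc
  refine (hw.norm.mul_prod ((integrable_min_one_sq_div_rpow hp hp').const_mul K)).mono'
    (hw.aestronglyMeasurable.comp_fst.mul (Measurable.aestronglyMeasurable ?_))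
    (Eventually.of_forall fun q => ?_)
  · exact (continuous_uncurry_secondDiff hφ.continuous).measurable.div (by fun_prop)
  · rw [norm_mul, norm_div, Real.norm_of_nonneg (by positivity : 0 ≤ ‖q.2‖ ^ p)]
    refine mul_le_mul_of_nonneg_left ?_ (norm_nonneg (w q.1))
    rw [← mul_div_assoc]
    gcongr
    exact hK _ _

theorem integrable_secondDiff_div_rpow (hp : Module.finrank ℝ F < p)
    (hp' : p < Module.finrank ℝ F + 2) {φ : F → ℝ} (hφ : ContDiff ℝ 2 φ)
    (hc : HasCompactSupport φ) (x : F) :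
    Integrable (fun z => secondDiff φ x z / ‖z‖ ^ p) := by
  obtain ⟨K, hK⟩ := exists_abs_secondDiff_le hφ hc
  refine ((integrable_min_one_sq_div_rpow hp hp').const_mul K).mono'
    (Measurable.aestronglyMeasurable ?_) (Eventually.of_forall fun z => ?_)
  · exact ((continuous_uncurry_secondDiff hφ.continuous).comp
      (.prodMk_right x)).measurable.div (by fun_prop)
  · rw [norm_div, Real.norm_of_nonneg (by positivity : 0 ≤ ‖z‖ ^ p), ← mul_div_assoc]
    gcongr
    exact hK _ _

-- Average the change of variables `y = x + z` with its reflection `y = x - z`.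
theorem setIntegral_compl_closedBall_sub_div_rpow (hp : Module.finrank ℝ F < p) {φ : F → ℝ}
    (hφ : Continuous φ) (hc : HasCompactSupport φ) (x : F) {ε : ℝ} (hε : 0 < ε) :
    ∫ y in (Metric.closedBall x ε)ᶜ, (φ x - φ y) / ‖x - y‖ ^ p =
      2⁻¹ * ∫ z in (Metric.closedBall 0 ε)ᶜ, secondDiff φ x z / ‖z‖ ^ p := by
  obtain ⟨A, hA⟩ := hφ.bounded_above_of_compact_support hc
  have integrable_comp : ∀ σ : F → F, Continuous σ → IntegrableOn
      (fun z => (φ x - φ (σ z)) / ‖z‖ ^ p) (Metric.closedBall 0 ε)ᶜ := by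
    intro σ hσ
    refine ((integrableOn_one_div_rpow_compl_closedBall hp hε).const_mul (2 * A)).mono'
      (Measurable.aestronglyMeasurable (by fun_prop)) (Eventually.of_forall fun z => ?_)
    rw [norm_div, Real.norm_of_nonneg (by positivity : 0 ≤ ‖z‖ ^ p), mul_one_div]
    gcongr
    exact (norm_sub_le _ _).trans (by linarith [hA x, hA (σ z)])
  have translate : ∫ y in (Metric.closedBall x ε)ᶜ, (φ x - φ y) / ‖x - y‖ ^ p =
      ∫ z in (Metric.closedBall 0 ε)ᶜ, (φ x - φ (x + z)) / ‖z‖ ^ p := by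
    rw [← (measurePreserving_add_left volume x).setIntegral_preimage_emb
      (measurableEmbedding_addLeft x)]
    simp [Set.preimage_compl]
  have reflect : ∫ y in (Metric.closedBall x ε)ᶜ, (φ x - φ y) / ‖x - y‖ ^ p =
      ∫ z in (Metric.closedBall 0 ε)ᶜ, (φ x - φ (x - z)) / ‖z‖ ^ p := by
    rw [← (volume.measurePreserving_sub_left x).setIntegral_preimage_emb
      (MeasurableEquiv.subLeft x).measurableEmbedding]
    congr 2 with z
    · simp
    · simp
  calc ∫ y in (Metric.closedBall x ε)ᶜ, (φ x - φ y) / ‖x - y‖ ^ p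
      = 2⁻¹ * ((∫ z in (Metric.closedBall 0 ε)ᶜ, (φ x - φ (x + z)) / ‖z‖ ^ p) +
          ∫ z in (Metric.closedBall 0 ε)ᶜ, (φ x - φ (x - z)) / ‖z‖ ^ p) := by
        rw [← translate, ← reflect]
        ring
    _ = 2⁻¹ * ∫ z in (Metric.closedBall 0 ε)ᶜ, secondDiff φ x z / ‖z‖ ^ p := by
        rw [← integral_add (integrable_comp _ (by fun_prop)) (integrable_comp _ (by fun_prop))]
        congr 2 with z
        rw [secondDiff]
        ring

end SecondDiff

section FracLaplacian

variable {n : ℕ} {s : ℝ}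

theorem fracConst_pos (hs0 : 0 < s) (hs1 : s < 1) : 0 < fracConst n s := by
  have : 0 < Real.Gamma (n / 2 + s) := Real.Gamma_pos_of_pos (by positivity)
  have : 0 < Real.Gamma (1 - s) := Real.Gamma_pos_of_pos (by linarith)
  unfold fracConst
  positivity

theorem finrank_lt_add_two_mul (hs0 : 0 < s) : Module.finrank ℝ (E n) < (n : ℝ) + 2 * s := by
  rw [finrank_euclideanSpace_fin]
  linarith

theorem add_two_mul_lt_finrank_add_two (hs1 : s < 1) :
    (n : ℝ) + 2 * s < Module.finrank ℝ (E n) + 2 := by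
  rw [finrank_euclideanSpace_fin]
  linarith

theorem fracLaplacian_eq (hs0 : 0 < s) (hs1 : s < 1) {φ : E n → ℝ}
    (hφ : ContDiff ℝ 2 φ) (hc : HasCompactSupport φ) (x : E n) :
    fracLaplacian s φ x =
      fracConst n s * (2⁻¹ * ∫ z, secondDiff φ x z / ‖z‖ ^ ((n : ℝ) + 2 * s)) := by
  have hint := integrable_secondDiff_div_rpow (finrank_lt_add_two_mul hs0)
    (add_two_mul_lt_finrank_add_two hs1) hφ hc x
  have hzero : secondDiff φ x 0 / ‖(0 : E n)‖ ^ ((n : ℝ) + 2 * s) = 0 := by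
    simp [secondDiff, two_mul]
  rw [fracLaplacian]
  congr 1
  refine (((tendsto_setIntegral_compl_closedBall hint hzero).const_mul 2⁻¹).congr' ?_).limUnder_eq
  filter_upwards [self_mem_nhdsWithin] with ε hε
  exact (setIntegral_compl_closedBall_sub_div_rpow (finrank_lt_add_two_mul hs0) hφ.continuous hc
    x hε).symm

theorem integrable_integral_mul_secondDiff_div_rpow (hs0 : 0 < s) (hs1 : s < 1) {φ w : E n → ℝ}
    (hφ : ContDiff ℝ 2 φ) (hc : HasCompactSupport φ) (hw : Integrable w) :
    Integrable (fun z : E n => (∫ x, w x * secondDiff φ x z) / ‖z‖ ^ ((n : ℝ) + 2 * s)) := by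
  have hint := (integrable_mul_secondDiff_div_rpow (finrank_lt_add_two_mul hs0)
    (add_two_mul_lt_finrank_add_two hs1) hφ hc hw).integral_prod_right
  simpa only [← mul_div_assoc, integral_div] using hint

theorem integral_mul_fracLaplacian (hs0 : 0 < s) (hs1 : s < 1) {φ w : E n → ℝ}
    (hφ : ContDiff ℝ 2 φ) (hc : HasCompactSupport φ) (hw : Integrable w) :
    ∫ x, w x * fracLaplacian s φ x = fracConst n s * (2⁻¹ *
      ∫ z, (∫ x, w x * secondDiff φ x z) / ‖z‖ ^ ((n : ℝ) + 2 * s)) := by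
  have hint := integrable_mul_secondDiff_div_rpow (finrank_lt_add_two_mul hs0)
    (add_two_mul_lt_finrank_add_two hs1) hφ hc hw
  calc ∫ x, w x * fracLaplacian s φ x
      = ∫ x, fracConst n s * 2⁻¹ *
          ∫ z, w x * (secondDiff φ x z / ‖z‖ ^ ((n : ℝ) + 2 * s)) := by
        congr 1 with x
        rw [fracLaplacian_eq hs0 hs1 hφ hc, integral_const_mul]
        ring
    _ = _ := by
        rw [integral_const_mul, integral_integral_swap hint]
        simp_rw [← integral_div, mul_div_assoc, mul_assoc]

theorem fracLaplacian_eq_of_notMem_tsupport {φ : E n → ℝ} {x : E n} (hx : x ∉ tsupport φ) :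
    fracLaplacian s φ x = -(fracConst n s * ∫ y, φ y / ‖x - y‖ ^ ((n : ℝ) + 2 * s)) := by
  obtain ⟨δ, hδ, hball⟩ := Metric.eventually_nhds_iff.1 (notMem_tsupport_iff_eventuallyEq.1 hx)
  rw [fracLaplacian, ← mul_neg, ← integral_neg]
  congr 1
  refine (tendsto_const_nhds.congr' ?_).limUnder_eq
  filter_upwards [(eventually_lt_nhds hδ).filter_mono nhdsWithin_le_nhds] with ε hε
  rw [setIntegral_eq_integral_of_forall_compl_eq_zero]
  · simp [image_eq_zero_of_notMem_tsupport hx, neg_div]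
  · intro y hy
    have hy' : dist y x < δ := lt_of_le_of_lt (by simpa using hy) hε
    simp [image_eq_zero_of_notMem_tsupport hx, hball hy']

end FracLaplacian

section Oscillation

variable {F G : Type*} [NormedAddCommGroup F] [MeasureSpace F] [BorelSpace F]
  [NormedAddCommGroup G]

theorem setLIntegral_ball_enorm_sub_eq [(volume : Measure F).IsAddRightInvariant]
    (v : F → G) (x : F) (ε : ℝ) :
    ∫⁻ y in Metric.ball x ε, ‖v y - v x‖ₑ =
      ∫⁻ z in Metric.ball (0 : F) ε, ‖v (z + x) - v x‖ₑ := by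
  rw [← (measurePreserving_add_right volume x).setLIntegral_comp_preimage_emb
    (measurableEmbedding_addRight x)]
  simp

variable [NormedSpace ℝ F] [FiniteDimensional ℝ F] [(volume : Measure F).IsAddHaarMeasure]

theorem tendsto_lintegral_enorm_translate_sub {v : F → G} (hv : Integrable v) :
    Tendsto (fun z => ∫⁻ x, ‖v (z + x) - v x‖ₑ) (𝓝 0) (𝓝 0) := by
  have hLp : MemLp v 1 volume := memLp_one_iff_integrable.2 hv
  have : Fact ((1 : ENNReal) ≠ ⊤) := ⟨ENNReal.one_ne_top⟩
  have translate_continuous : Continuous fun z : F => DomAddAct.mk z +ᵥ hLp.toLp v := by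
    fun_prop
  have hlim := (translate_continuous.edist (continuous_const (y := hLp.toLp v))).tendsto 0
  simpa [DomAddAct.mk_vadd_toLp, Lp.edist_toLp_toLp, eLpNorm_one_eq_lintegral_enorm] using hlim

theorem eventually_lintegral_ball_enorm_sub_le {v : F → G} (hv : Integrable v) {δ : ENNReal}
    (hδ : δ ≠ 0) :
    ∀ᶠ ε : ℝ in 𝓝[>] 0, ∫⁻ x, ∫⁻ y in Metric.ball x ε, ‖v y - v x‖ₑ ≤
      δ * volume (Metric.ball (0 : F) ε) := by
  obtain ⟨ε₀, hε₀, hsmall⟩ := Metric.eventually_nhds_iff.1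
    ((tendsto_lintegral_enorm_translate_sub hv).eventually_le_const (pos_iff_ne_zero.2 hδ))
  filter_upwards [Ioo_mem_nhdsGT hε₀] with ε hε
  have hmeas : AEMeasurable (fun q : F × F => ‖v (q.2 + q.1) - v q.1‖ₑ)
      (volume.prod (volume.restrict (Metric.ball 0 ε))) := by
    have hadd : AEStronglyMeasurable (fun q : F × F => v (q.2 + q.1)) (volume.prod volume) :=
      (hv.aestronglyMeasurable.comp_snd (μ := volume)).comp_quasiMeasurePreserving
        (measurePreserving_prod_add_swap volume volume).quasiMeasurePreserving
    exact (hadd.sub hv.aestronglyMeasurable.comp_fst).enorm.mono_measure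
      (Measure.prod_mono le_rfl Measure.restrict_le_self)
  calc ∫⁻ x, ∫⁻ y in Metric.ball x ε, ‖v y - v x‖ₑ
      = ∫⁻ z in Metric.ball (0 : F) ε, ∫⁻ x, ‖v (z + x) - v x‖ₑ := by
        simp_rw [setLIntegral_ball_enorm_sub_eq]
        exact lintegral_lintegral_swap hmeas
    _ ≤ ∫⁻ _ in Metric.ball (0 : F) ε, δ :=
        setLIntegral_mono measurable_const fun z hz => hsmall (lt_trans hz hε.2)
    _ = δ * volume (Metric.ball (0 : F) ε) := setLIntegral_const _ _

theorem eventually_lintegral_enorm_integral_sub_mul_le {v : F → ℝ} (hv : Integrable v)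
    {δ : ENNReal} (hδ : δ ≠ 0) :
    ∀ᶠ ε : ℝ in 𝓝[>] 0, ∀ (B : ℝ) (J : F → F → ℝ),
      (∀ x y, |J x y| ≤ B / volume.real (Metric.ball (0 : F) ε)) →
      (∀ x y, ε ≤ ‖x - y‖ → J x y = 0) →
      ∫⁻ x, ‖∫ y, (v y - v x) * J x y‖ₑ ≤ ENNReal.ofReal B * δ := by
  filter_upwards [eventually_lintegral_ball_enorm_sub_le hv hδ, self_mem_nhdsWithin]
    with ε hosc hε B J hJ hJ0
  have hball : 0 < volume.real (Metric.ball (0 : F) ε) :=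
    ENNReal.toReal_pos (Metric.measure_ball_pos volume _ hε).ne' measure_ball_lt_top.ne
  have pointwise (x : F) : ‖∫ y, (v y - v x) * J x y‖ₑ ≤
      ENNReal.ofReal (B / volume.real (Metric.ball (0 : F) ε)) *
        ∫⁻ y in Metric.ball x ε, ‖v y - v x‖ₑ := by
    rw [← setIntegral_eq_integral_of_forall_compl_eq_zero (s := Metric.ball x ε) fun y hy => by
      rw [hJ0 x y (not_lt.1 fun h => hy (mem_ball_iff_norm'.2 h)), mul_zero],
      ← lintegral_const_mul' _ _ ENNReal.ofReal_ne_top]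
    refine (enorm_integral_le_lintegral_enorm _).trans (lintegral_mono fun y => ?_)
    rw [enorm_mul, mul_comm, Real.enorm_eq_ofReal_abs (J x y)]
    gcongr
    exact hJ x y
  calc ∫⁻ x, ‖∫ y, (v y - v x) * J x y‖ₑ
      ≤ ENNReal.ofReal (B / volume.real (Metric.ball (0 : F) ε)) *
          (δ * volume (Metric.ball (0 : F) ε)) := by
        refine (lintegral_mono pointwise).trans ?_
        rw [lintegral_const_mul' _ _ ENNReal.ofReal_ne_top]
        gcongr
    _ = ENNReal.ofReal B * δ := by
        rw [← ofReal_measureReal measure_ball_lt_top.ne, mul_left_comm,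
          ← ENNReal.ofReal_mul' hball.le, div_mul_cancel₀ _ hball.ne', mul_comm]

end Oscillation

section Mollifier

theorem integrable_mul_mul_of_bdd {X : Type*} [TopologicalSpace X] [SecondCountableTopology X]
    [MeasurableSpace X] [OpensMeasurableSpace X] {μ : Measure X} [SFinite μ] {f g : X → ℝ}
    (hf : Integrable f μ) (hg : Integrable g μ) {J : X × X → ℝ} (hJ : Continuous J) {B : ℝ}
    (hB : ∀ q, |J q| ≤ B) :
    Integrable (fun q : X × X => f q.1 * (g q.2 * J q)) (μ.prod μ) := by
  simpa only [mul_assoc] using (hf.mul_prod hg).mul_bdd hJ.aestronglyMeasurable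
    (Eventually.of_forall hB)

variable {F : Type*} [NormedAddCommGroup F] [MeasureSpace F]

/-- The convolution of `f` with the kernel `ρ`, used to regularize `f`; the kernel is the second
factor, so that it is evaluated at `x - y`. -/
def mollify (ρ f : F → ℝ) : F → ℝ :=
  convolution f ρ (ContinuousLinearMap.lsmul ℝ ℝ) volume

theorem mollify_apply (ρ f : F → ℝ) (x : F) : mollify ρ f x = ∫ y, f y * ρ (x - y) := rfl

theorem mollify_add_right [BorelSpace F] [(volume : Measure F).IsAddRightInvariant]
    (ρ f : F → ℝ) (x z : F) :
    mollify ρ f (x + z) = mollify ρ (fun y => f (y + z)) x := by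
  rw [mollify_apply, ← integral_add_right_eq_self _ z]
  simp [mollify_apply]

variable [NormedSpace ℝ F]

/-- An even mollifier at scale `ε`, of size `A / |B_ε|` and with gradient of size
`A / (ε |B_ε|)`; `A` is kept separate from `ε` so that estimates are uniform in the scale. -/
structure IsMollifier (A ε : ℝ) (ρ : F → ℝ) : Prop where
  contDiff : ContDiff ℝ (⊤ : ℕ∞) ρ
  even : Function.Even ρ
  nonneg : ∀ z, 0 ≤ ρ z
  integral_eq_one : ∫ z, ρ z = 1
  eq_zero_of_le : ∀ z, ε ≤ ‖z‖ → ρ z = 0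
  le : ∀ z, ρ z ≤ A / volume.real (Metric.ball (0 : F) ε)
  norm_fderiv_le : ∀ z, ‖fderiv ℝ ρ z‖ ≤ A / (ε * volume.real (Metric.ball (0 : F) ε))

namespace IsMollifier

variable {A ε : ℝ} {ρ f g : F → ℝ}

theorem contDiff_one (h : IsMollifier A ε ρ) : ContDiff ℝ 1 ρ :=
  h.contDiff.of_le (by exact_mod_cast le_top)

theorem abs_le (h : IsMollifier A ε ρ) (z : F) :
    |ρ z| ≤ A / volume.real (Metric.ball (0 : F) ε) :=
  (abs_of_nonneg (h.nonneg z)).trans_le (h.le z)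

theorem sub_comm (h : IsMollifier A ε ρ) (x y : F) : ρ (x - y) = ρ (y - x) := by
  rw [← h.even, neg_sub]

theorem fderiv_sub_comm (h : IsMollifier A ε ρ) (x y : F) :
    fderiv ℝ ρ (x - y) = -fderiv ℝ ρ (y - x) := by
  have heven : ρ = fun z => ρ ((-1 : ℝ) • z) := funext fun z => by simp [h.even z]
  conv_lhs => rw [heven, fderiv_comp_smul, smul_sub, neg_one_smul, neg_one_smul, neg_one_smul]
  rw [neg_sub_neg]

theorem fderiv_eq_zero_of_le (h : IsMollifier A ε ρ) {z : F} (hz : ε ≤ ‖z‖) :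
    fderiv ℝ ρ z = 0 :=
  IsLocalMin.fderiv_eq_zero <| Eventually.of_forall fun y => by
    simpa only [h.eq_zero_of_le z hz] using h.nonneg y

theorem mollify_nonneg (h : IsMollifier A ε ρ) (hf : ∀ y, 0 ≤ f y) (x : F) :
    0 ≤ mollify ρ f x :=
  integral_nonneg fun y => mul_nonneg (hf y) (h.nonneg _)

theorem mollify_eq_zero (h : IsMollifier A ε ρ) {y : F}
    (hf : ∀ x ∈ Metric.ball y ε, f x = 0) : mollify ρ f y = 0 := by
  refine integral_eq_zero_of_ae (Eventually.of_forall fun x => ?_)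
  by_cases hx : ‖y - x‖ < ε
  · simp [hf x (mem_ball_iff_norm'.2 hx)]
  · simp [h.eq_zero_of_le _ (not_lt.1 hx)]

theorem integrable_mul_comp_sub [BorelSpace F] (h : IsMollifier A ε ρ) (hf : Integrable f)
    (x : F) : Integrable (fun y => f y * ρ (x - y)) :=
  hf.mul_bdd (h.contDiff.continuous.comp
    (continuous_const.sub continuous_id)).aestronglyMeasurable
    (Eventually.of_forall fun _ => h.abs_le _)

theorem secondDiff_mollify [BorelSpace F] [(volume : Measure F).IsAddRightInvariant]
    (h : IsMollifier A ε ρ) (hg : Integrable g) (x z : F) :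
    secondDiff (mollify ρ g) x z = mollify ρ (fun y => secondDiff g y z) x := by
  have hself := (h.integrable_mul_comp_sub hg x).const_mul 2
  have hplus := h.integrable_mul_comp_sub (hg.comp_add_right z) x
  have hminus := h.integrable_mul_comp_sub (hg.comp_sub_right z) x
  have hdiff : Integrable fun y => 2 * (g y * ρ (x - y)) - g (y + z) * ρ (x - y) :=
    hself.sub hplus
  simp_rw [secondDiff, sub_eq_add_neg x, mollify_add_right, mollify_apply, ← sub_eq_add_neg,
    sub_mul, mul_assoc]
  rw [integral_sub hdiff hminus, integral_sub hself hplus, integral_const_mul]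

variable [FiniteDimensional ℝ F]

theorem hasCompactSupport (h : IsMollifier A ε ρ) : HasCompactSupport ρ :=
  HasCompactSupport.intro (isCompact_closedBall 0 ε) fun z hz =>
    h.eq_zero_of_le z (by simpa using (not_le.1 (by simpa using hz)).le)

variable [BorelSpace F]

theorem contDiff_mollify (h : IsMollifier A ε ρ) (hf : Integrable f) :
    ContDiff ℝ (⊤ : ℕ∞) (mollify ρ f) :=
  h.hasCompactSupport.contDiff_convolution_right _ hf.locallyIntegrable h.contDiff

variable [(volume : Measure F).IsAddHaarMeasure]

theorem integrable_mul_mul_comp_sub (h : IsMollifier A ε ρ) (hf : Integrable f)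
    (hg : Integrable g) : Integrable (fun q : F × F => f q.1 * (g q.2 * ρ (q.1 - q.2))) :=
  integrable_mul_mul_of_bdd hf hg (h.contDiff.continuous.comp (continuous_fst.sub continuous_snd))
    fun _ => h.abs_le _

theorem integrable (h : IsMollifier A ε ρ) : Integrable ρ :=
  h.contDiff.continuous.integrable_of_hasCompactSupport h.hasCompactSupport

theorem fderiv_mollify (h : IsMollifier A ε ρ) (hf : Integrable f) (x w : F) :
    fderiv ℝ (mollify ρ f) x w = ∫ y, f y * fderiv ℝ ρ (x - y) w := by
  have hderiv := h.hasCompactSupport.hasFDerivAt_convolution_right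
    (ContinuousLinearMap.lsmul ℝ ℝ) hf.locallyIntegrable h.contDiff_one x
  rw [mollify, hderiv.fderiv, convolution_precompR_apply _ hf.locallyIntegrable
    (h.hasCompactSupport.fderiv ℝ) (h.contDiff_one.continuous_fderiv one_ne_zero)]
  rfl

theorem integrable_mollify (h : IsMollifier A ε ρ) (hf : Integrable f) :
    Integrable (mollify ρ f) :=
  hf.integrable_convolution _ h.integrable

theorem le_mollify (h : IsMollifier A ε ρ) (hf : Integrable f) {y : F} {a : ℝ}
    (ha : ∀ᵐ x, x ∈ Metric.ball y ε → a ≤ f x) : a ≤ mollify ρ f y := by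
  have average_const : a = ∫ x, a * ρ (y - x) := by
    rw [integral_const_mul, integral_sub_left_eq_self ρ volume y, h.integral_eq_one, mul_one]
  rw [average_const, mollify_apply]
  refine integral_mono_ae ((h.integrable.comp_sub_left y).const_mul a)
    (h.integrable_mul_comp_sub hf y) ?_
  filter_upwards [ha] with x hx
  by_cases hxy : ‖y - x‖ < ε
  · exact mul_le_mul_of_nonneg_right (hx (mem_ball_iff_norm'.2 hxy)) (h.nonneg _)
  · simp [h.eq_zero_of_le _ (not_lt.1 hxy)]

theorem mollify_sub (h : IsMollifier A ε ρ) (hf : Integrable f) (x : F) :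
    mollify ρ f x - f x = ∫ y, (f y - f x) * ρ (x - y) := by
  simp_rw [sub_mul]
  rw [integral_sub (h.integrable_mul_comp_sub hf x) ((h.integrable.comp_sub_left x).const_mul _),
    integral_const_mul, integral_sub_left_eq_self ρ volume x, h.integral_eq_one, mul_one,
    mollify_apply]

theorem integral_mul_mollify (h : IsMollifier A ε ρ) (hf : Integrable f) (hg : Integrable g) :
    ∫ x, f x * mollify ρ g x = ∫ x, mollify ρ f x * g x := by
  simp_rw [mollify_apply, ← integral_const_mul, ← integral_mul_const]
  rw [integral_integral_swap (h.integrable_mul_mul_comp_sub hf hg)]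
  simp_rw [h.sub_comm, mul_right_comm, mul_assoc]

end IsMollifier

variable [FiniteDimensional ℝ F] [BorelSpace F] [(volume : Measure F).IsAddHaarMeasure]

theorem IsMollifier.comp_inv_smul {A ε : ℝ} {η : F → ℝ} (hη : IsMollifier A 1 η) (hε : 0 < ε) :
    IsMollifier A ε fun z => (ε ^ Module.finrank ℝ F)⁻¹ * η (ε⁻¹ • z) := by
  have hvol : volume.real (Metric.ball (0 : F) ε) =
      ε ^ Module.finrank ℝ F * volume.real (Metric.ball (0 : F) 1) := by
    rw [measureReal_def, Measure.addHaar_ball_of_pos _ _ hε, ENNReal.toReal_mul,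
      ENNReal.toReal_ofReal (by positivity), measureReal_def]
  have hcomp : ContDiff ℝ (⊤ : ℕ∞) fun z => η (ε⁻¹ • z) :=
    hη.contDiff.comp (contDiff_const_smul _)
  refine ⟨contDiff_const.mul hcomp, fun z => ?_, fun z => ?_, ?_, fun z hz => ?_, fun z => ?_,
    fun z => ?_⟩
  · rw [smul_neg, hη.even]
  · exact mul_nonneg (by positivity) (hη.nonneg _)
  · rw [integral_const_mul, Measure.integral_comp_smul_of_nonneg _ _ _ (hR := by positivity),
      hη.integral_eq_one]
    simp [hε.ne']
  · rw [hη.eq_zero_of_le, mul_zero]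
    rwa [norm_smul, Real.norm_of_nonneg (by positivity), ← div_eq_inv_mul, one_le_div hε]
  · rw [hvol, mul_comm (ε ^ _), ← div_div, div_eq_inv_mul _ (ε ^ _)]
    gcongr
    exact hη.le _
  · rw [hvol, fderiv_const_mul (hcomp.differentiable (by simp) z), fderiv_comp_smul, norm_smul,
      norm_smul, Real.norm_of_nonneg (by positivity), Real.norm_of_nonneg (by positivity)]
    calc (ε ^ Module.finrank ℝ F)⁻¹ * (ε⁻¹ * ‖fderiv ℝ η (ε⁻¹ • z)‖)
        ≤ (ε ^ Module.finrank ℝ F)⁻¹ *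
            (ε⁻¹ * (A / (1 * volume.real (Metric.ball (0 : F) 1)))) := by
          gcongr
          exact hη.norm_fderiv_le _
      _ = A / (ε * (ε ^ Module.finrank ℝ F * volume.real (Metric.ball (0 : F) 1))) := by
          field_simp

variable (F) in
theorem exists_isMollifier : ∃ A : ℝ, ∀ ε : ℝ, 0 < ε → ∃ ρ : F → ℝ, IsMollifier A ε ρ := by
  let f : ContDiffBump (0 : F) := ⟨1 / 2, 1, by norm_num, by norm_num⟩
  let η : F → ℝ := f.normed volume
  have hcont : ContDiff ℝ (⊤ : ℕ∞) η := f.contDiff_normed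
  have hc : HasCompactSupport η := f.hasCompactSupport_normed
  obtain ⟨A₁, hA₁⟩ := hcont.continuous.bounded_above_of_compact_support hc
  obtain ⟨A₂, hA₂⟩ := (hcont.continuous_fderiv (by simp)).bounded_above_of_compact_support
    (hc.fderiv ℝ)
  have hvol : 0 < volume.real (Metric.ball (0 : F) 1) :=
    ENNReal.toReal_pos (Metric.measure_ball_pos _ _ one_pos).ne' measure_ball_lt_top.ne
  refine ⟨max A₁ A₂ * volume.real (Metric.ball (0 : F) 1), fun ε hε =>
    ⟨_, IsMollifier.comp_inv_smul (η := η) ⟨hcont, f.normed_neg, f.nonneg_normed,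
      f.integral_normed, fun z hz => ?_, fun z => ?_, fun z => ?_⟩ hε⟩⟩
  · rw [← Function.notMem_support, f.support_normed_eq]
    simpa using hz
  · rw [mul_div_cancel_right₀ _ hvol.ne']
    exact (le_abs_self _).trans ((hA₁ z).trans (le_max_left _ _))
  · rw [one_mul, mul_div_cancel_right₀ _ hvol.ne']
    exact (hA₂ z).trans (le_max_right _ _)

theorem integral_mul_secondDiff {w g : F → ℝ} (hw : Integrable w) (hg : Continuous g)
    (hgc : HasCompactSupport g) (z : F) :
    ∫ x, w x * secondDiff g x z = ∫ x, (w x - w (x + z)) * (g x - g (x + z)) := by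
  obtain ⟨G, hG⟩ := hg.bounded_above_of_compact_support hgc
  have hint : ∀ {f : F → ℝ} (a c : F), Integrable f →
      Integrable (fun x => f x * (g (x + a) - g (x + c))) := fun a c hf =>
    hf.mul_bdd (by fun_prop) (Eventually.of_forall fun x =>
      (norm_sub_le _ _).trans (add_le_add (hG _) (hG _)))
  have translate : ∫ x, w x * (g (x + -z) - g (x + 0)) =
      ∫ x, w (x + z) * (g (x + 0) - g (x + z)) := by
    rw [← integral_add_right_eq_self _ z]
    simp
  calc ∫ x, w x * secondDiff g x z
      = ∫ x, (w x * (g (x + 0) - g (x + z)) - w x * (g (x + -z) - g (x + 0))) := by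
        congr 1 with x
        rw [secondDiff, add_zero, ← sub_eq_add_neg]
        ring
    _ = ∫ x, (w x * (g (x + 0) - g (x + z)) - w (x + z) * (g (x + 0) - g (x + z))) := by
        rw [integral_sub (hint _ _ hw) (hint _ _ hw), translate,
          integral_sub (hint _ _ hw) (hint _ _ (hw.comp_add_right z))]
    _ = ∫ x, (w x - w (x + z)) * (g x - g (x + z)) := by
        simp_rw [add_zero, sub_mul]

theorem IsMollifier.integral_mul_secondDiff_mollify {A ε : ℝ} {ρ v g : F → ℝ}
    (h : IsMollifier A ε ρ) (hv : Integrable v) (hg : Continuous g) (hgc : HasCompactSupport g)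
    (z : F) :
    ∫ x, v x * secondDiff (mollify ρ g) x z =
      ∫ x, (mollify ρ v x - mollify ρ v (x + z)) * (g x - g (x + z)) := by
  have hgi : Integrable g := hg.integrable_of_hasCompactSupport hgc
  have hsd : Integrable fun x => secondDiff g x z :=
    ((hgi.const_mul 2).sub (hgi.comp_add_right z)).sub (hgi.comp_sub_right z)
  simp_rw [h.secondDiff_mollify hgi]
  rw [h.integral_mul_mollify hv hsd, integral_mul_secondDiff (h.integrable_mollify hv) hg hgc]

end Mollifier

section Energy

theorem sub_mul_negPart_sub_nonpos (a c : ℝ) : (a - c) * (a⁻ - c⁻) ≤ 0 := by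
  rcases le_total a c with hac | hac
  · exact mul_nonpos_of_nonpos_of_nonneg (sub_nonpos.2 hac) (sub_nonneg.2 (negPart_anti hac))
  · exact mul_nonpos_of_nonneg_of_nonpos (sub_nonneg.2 hac) (sub_nonpos.2 (negPart_anti hac))

variable {n : ℕ} {s A ε : ℝ} {ρ v : E n → ℝ}

theorem integral_mul_fracLaplacian_mollify_negPart_nonpos (hs0 : 0 < s) (hs1 : s < 1)
    (h : IsMollifier A ε ρ) (hv : Integrable v) (hgc : HasCompactSupport fun x => (mollify ρ v x)⁻)
    (hΦc : HasCompactSupport (mollify ρ fun x => (mollify ρ v x)⁻)) :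
    ∫ x, v x * fracLaplacian s (mollify ρ fun x => (mollify ρ v x)⁻) x ≤ 0 := by
  have hg : Continuous fun x => (mollify ρ v x)⁻ :=
    continuous_negPart.comp (h.contDiff_mollify hv).continuous
  have hΦ : ContDiff ℝ 2 (mollify ρ fun x => (mollify ρ v x)⁻) :=
    mod_cast contDiff_infty.1 (h.contDiff_mollify (hg.integrable_of_hasCompactSupport hgc)) 2
  rw [integral_mul_fracLaplacian hs0 hs1 hΦ hΦc hv]
  refine mul_nonpos_of_nonneg_of_nonpos (fracConst_pos hs0 hs1).le
    (mul_nonpos_of_nonneg_of_nonpos (by norm_num) (integral_nonpos fun z => ?_))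
  refine div_nonpos_of_nonpos_of_nonneg ?_ (by positivity)
  rw [h.integral_mul_secondDiff_mollify hv hg hgc]
  exact integral_nonpos fun x => sub_mul_negPart_sub_nonpos _ _

end Energy

section Divergence

variable {n : ℕ} {F : E n → E n} {x : E n}

theorem fderiv_coord (hF : DifferentiableAt ℝ F x) (i : Fin n) (w : E n) :
    fderiv ℝ (fun y => F y i) x w = fderiv ℝ F x w i :=
  congrArg (· w) ((EuclideanSpace.proj (𝕜 := ℝ) i).hasFDerivAt.comp x hF.hasFDerivAt).fderiv

theorem divergence_eq_sum_fderiv_coord (hF : DifferentiableAt ℝ F x) :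
    divergence F x = ∑ i, fderiv ℝ F x (EuclideanSpace.single i 1) i :=
  Finset.sum_congr rfl fun i _ => fderiv_coord hF i _

theorem abs_divergence_le (hF : DifferentiableAt ℝ F x) :
    |divergence F x| ≤ n * ‖fderiv ℝ F x‖ := by
  have coord_le (i : Fin n) :
      |fderiv ℝ F x (EuclideanSpace.single i 1) i| ≤ ‖fderiv ℝ F x‖ :=
    (PiLp.norm_apply_le (fderiv ℝ F x (EuclideanSpace.single i 1)) i).trans
      ((fderiv ℝ F x).unit_le_opNorm _ (by simp))
  rw [divergence_eq_sum_fderiv_coord hF]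
  calc |∑ i, fderiv ℝ F x (EuclideanSpace.single i 1) i|
      ≤ ∑ i, |fderiv ℝ F x (EuclideanSpace.single i 1) i| := Finset.abs_sum_le_sum_abs _ _
    _ ≤ ∑ _ : Fin n, ‖fderiv ℝ F x‖ := Finset.sum_le_sum fun i _ => coord_le i
    _ = n * ‖fderiv ℝ F x‖ := by simp

theorem continuous_divergence (hF : ContDiff ℝ 1 F) : Continuous (divergence F) := by
  have hsum : divergence F = fun x => ∑ i, fderiv ℝ F x (EuclideanSpace.single i 1) i :=
    funext fun x => divergence_eq_sum_fderiv_coord (hF.differentiable one_ne_zero x)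
  have := hF.continuous_fderiv one_ne_zero
  rw [hsum]
  fun_prop

theorem divergence_sub_const (F : E n → E n) (c x : E n) :
    divergence (fun y => F y - c) x = divergence F x := by
  simp [divergence, fderiv_sub_const]

theorem divergence_smul {φ : E n → ℝ} (hφ : DifferentiableAt ℝ φ x)
    (hF : DifferentiableAt ℝ F x) :
    divergence (fun y => φ y • F y) x = fderiv ℝ φ x (F x) + φ x * divergence F x := by
  have expand : fderiv ℝ φ x (F x) = ∑ i, F x i * fderiv ℝ φ x (EuclideanSpace.single i 1) := by
    conv_lhs => rw [← (EuclideanSpace.basisFun (Fin n) ℝ).sum_repr (F x)]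
    simp
  have product_rule (i : Fin n) :
      fderiv ℝ (fun y => φ y * F y i) x =
        φ x • fderiv ℝ (fun y => F y i) x + F x i • fderiv ℝ φ x :=
    fderiv_fun_mul hφ (by fun_prop)
  simp only [divergence, PiLp.smul_apply, smul_eq_mul, product_rule, add_apply, smul_apply,
    Finset.sum_add_distrib, ← Finset.mul_sum]
  rw [expand, add_comm]

theorem divergence_congr {G : E n → E n} (h : F =ᶠ[𝓝 x] G) : divergence F x = divergence G x :=
  Finset.sum_congr rfl fun i _ => by
    have hi : (fun y => F y i) =ᶠ[𝓝 x] fun y => G y i := h.mono fun y hy =>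
      congrArg (fun z : E n => z i) hy
    rw [hi.fderiv_eq]

theorem divergence_eq_zero_of_notMem_tsupport (hx : x ∉ tsupport F) : divergence F x = 0 := by
  rw [divergence_congr (notMem_tsupport_iff_eventuallyEq.1 hx)]
  simp [divergence]

theorem hasCompactSupport_divergence (hF : HasCompactSupport F) :
    HasCompactSupport (divergence F) :=
  HasCompactSupport.intro hF fun _ hx => divergence_eq_zero_of_notMem_tsupport hx

theorem integral_fderiv_eq_zero {f : E n → ℝ} (hf : ContDiff ℝ 1 f) (hc : HasCompactSupport f)
    (w : E n) : ∫ x, fderiv ℝ f x w = 0 := by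
  have hint : Integrable fun x => fderiv ℝ f x w :=
    ((hf.continuous_fderiv one_ne_zero).clm_apply
      continuous_const).integrable_of_hasCompactSupport (hc.fderiv_apply (𝕜 := ℝ) w)
  simpa using integral_mul_fderiv_eq_neg_fderiv_mul_of_integrable (𝕜 := ℝ) (μ := volume)
    (f := fun _ : E n => (1 : ℝ)) (g := f) (v := w) (by simp) (by simpa using hint)
    (by simpa using hf.continuous.integrable_of_hasCompactSupport hc) (by fun_prop)
    (fun x _ => hf.differentiable one_ne_zero x)

theorem integral_divergence_eq_zero (hF : ContDiff ℝ 1 F) (hc : HasCompactSupport F) :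
    ∫ x, divergence F x = 0 := by
  have hFi (i : Fin n) : ContDiff ℝ 1 fun y => F y i := by fun_prop
  have hci (i : Fin n) : HasCompactSupport fun y => F y i :=
    hc.comp_left (g := fun w : E n => w i) rfl
  unfold divergence
  rw [integral_finsetSum _ fun i _ => (((hFi i).continuous_fderiv one_ne_zero).clm_apply
    continuous_const).integrable_of_hasCompactSupport ((hci i).fderiv_apply (𝕜 := ℝ) _)]
  exact Finset.sum_eq_zero fun i _ => integral_fderiv_eq_zero (hFi i) (hci i) _

end Divergence

section NegPart

theorem hasDerivAt_half_sq_negPart (t : ℝ) : HasDerivAt (fun t : ℝ => t⁻ ^ 2 / 2) (-t⁻) t := by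
  have : Continuous fun t : ℝ => t⁻ := continuous_negPart
  have off_zero (t : ℝ) (ht : t ≠ 0) : HasDerivAt (fun t : ℝ => t⁻ ^ 2 / 2) (-t⁻) t := by
    rcases ht.lt_or_gt with ht | ht
    · have hquad : HasDerivAt (fun t : ℝ => t ^ 2 / 2) (-t⁻) t := by
        simpa [negPart_of_nonpos ht.le] using (hasDerivAt_pow 2 t).div_const 2
      refine hquad.congr_of_eventuallyEq ?_
      filter_upwards [eventually_lt_nhds ht] with x hx
      rw [negPart_of_nonpos hx.le, neg_sq]
    · have hzero : HasDerivAt (fun _ : ℝ => (0 : ℝ)) (-t⁻) t := by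
        simpa [negPart_of_nonneg ht.le] using hasDerivAt_const t (0 : ℝ)
      refine hzero.congr_of_eventuallyEq ?_
      filter_upwards [eventually_gt_nhds ht] with x hx
      simp [negPart_of_nonneg hx.le]
  rcases eq_or_ne t 0 with rfl | ht
  · exact hasDerivAt_of_hasDerivAt_of_ne off_zero (by fun_prop) (by fun_prop)
  · exact off_zero t ht

theorem contDiff_half_sq_negPart : ContDiff ℝ 1 (fun t : ℝ => t⁻ ^ 2 / 2) := by
  rw [contDiff_one_iff_deriv, funext fun t => (hasDerivAt_half_sq_negPart t).deriv]
  exact ⟨fun t => (hasDerivAt_half_sq_negPart t).differentiableAt, continuous_negPart.neg⟩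

variable {n : ℕ}

theorem integral_negPart_mul_fderiv {w : E n → ℝ} (hw : ContDiff ℝ 1 w) {b : E n → E n}
    (hb : ContDiff ℝ 1 b) (hbc : HasCompactSupport b) :
    ∫ x, (w x)⁻ * fderiv ℝ w x (b x) = ∫ x, (w x)⁻ ^ 2 / 2 * divergence b x := by
  set ψ : E n → ℝ := fun x => (w x)⁻ ^ 2 / 2
  have hψ : ContDiff ℝ 1 ψ := contDiff_half_sq_negPart.comp hw
  have fderiv_ψ (x : E n) : fderiv ℝ ψ x = (-(w x)⁻) • fderiv ℝ w x :=
    ((hasDerivAt_half_sq_negPart (w x)).comp_hasFDerivAt x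
      (hw.differentiable one_ne_zero x).hasFDerivAt).fderiv
  have leibniz (x : E n) : divergence (fun y => ψ y • b y) x =
      ψ x * divergence b x - (w x)⁻ * fderiv ℝ w x (b x) := by
    rw [divergence_smul (hψ.differentiable one_ne_zero x) (hb.differentiable one_ne_zero x),
      fderiv_ψ, smul_apply, smul_eq_mul]
    ring
  have : Continuous fun x => (w x)⁻ := continuous_negPart.comp hw.continuous
  have := hw.continuous_fderiv one_ne_zero
  have := hb.continuous
  have htransport : Integrable fun x => (w x)⁻ * fderiv ℝ w x (b x) :=
    Continuous.integrable_of_hasCompactSupport (by fun_prop)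
      (HasCompactSupport.intro hbc fun x hx => by simp [image_eq_zero_of_notMem_tsupport hx])
  have hdiv : Integrable fun x => ψ x * divergence b x :=
    (hψ.continuous.mul (continuous_divergence hb)).integrable_of_hasCompactSupport
      (hasCompactSupport_divergence hbc).mul_left
  have hzero : ∫ x, divergence (fun y => ψ y • b y) x = 0 :=
    integral_divergence_eq_zero (hψ.smul hb) (hbc.smul_left (f := ψ))
  simp_rw [leibniz] at hzero
  rw [integral_sub hdiv htransport] at hzero
  linarith

end NegPart

section Commutator

variable {n : ℕ} {A ε : ℝ} {ρ : E n → ℝ} {b : E n → E n} {v g : E n → ℝ}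

/-- The kernel of the commutator between mollification by `ρ` and the transport operator
`b · ∇`; it is the error made when a mollifier is moved across the drift term. -/
def commKernel (ρ : E n → ℝ) (b : E n → E n) (x y : E n) : ℝ :=
  fderiv ℝ ρ (x - y) (b x - b y) + ρ (x - y) * divergence b y

theorem commKernel_eq_zero_of_le (h : IsMollifier A ε ρ) {x y : E n} (hxy : ε ≤ ‖x - y‖) :
    commKernel ρ b x y = 0 := by
  simp [commKernel, h.fderiv_eq_zero_of_le hxy, h.eq_zero_of_le _ hxy]

theorem continuous_commKernel (h : IsMollifier A ε ρ) (hb : ContDiff ℝ 1 b) :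
    Continuous fun q : E n × E n => commKernel ρ b q.1 q.2 := by
  have hρ := h.contDiff_one.continuous_fderiv one_ne_zero
  have hρcont := h.contDiff.continuous
  have hbcont := hb.continuous
  have hdiv := continuous_divergence hb
  unfold commKernel
  fun_prop

theorem abs_commKernel_le (h : IsMollifier A ε ρ) (hε : 0 < ε) {L : NNReal}
    (hL : LipschitzWith L b) {D : ℝ} (hD : ∀ x, |divergence b x| ≤ D) (x y : E n) :
    |commKernel ρ b x y| ≤ A * (L + D) / volume.real (Metric.ball (0 : E n) ε) := by
  have hD0 : 0 ≤ D := (abs_nonneg _).trans (hD 0)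
  have hA : 0 ≤ A / volume.real (Metric.ball (0 : E n) ε) := (h.nonneg 0).trans (h.le 0)
  rw [mul_div_right_comm]
  rcases le_or_gt ε ‖x - y‖ with hxy | hxy
  · rw [commKernel_eq_zero_of_le h hxy, abs_zero]
    positivity
  · have stretch : |fderiv ℝ ρ (x - y) (b x - b y)| ≤
        A / (ε * volume.real (Metric.ball (0 : E n) ε)) * (L * ε) :=
      (fderiv ℝ ρ (x - y)).le_of_opNorm_le_of_le (h.norm_fderiv_le _)
        ((hL.norm_sub_le x y).trans (by gcongr))
    have dilate : |ρ (x - y) * divergence b y| ≤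
        A / volume.real (Metric.ball (0 : E n) ε) * D := by
      rw [abs_mul]
      exact mul_le_mul (h.abs_le _) (hD y) (abs_nonneg _) hA
    calc |commKernel ρ b x y|
        ≤ A / (ε * volume.real (Metric.ball (0 : E n) ε)) * (L * ε) +
            A / volume.real (Metric.ball (0 : E n) ε) * D :=
          (abs_add_le _ _).trans (add_le_add stretch dilate)
      _ = A / volume.real (Metric.ball (0 : E n) ε) * (L + D) := by
          field_simp

-- The kernel is the divergence in `y` of the compactly supported field `ρ (x - y) (b y - b x)`.
theorem integral_commKernel (h : IsMollifier A ε ρ) (hb : ContDiff ℝ 1 b) (x : E n) :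
    ∫ y, commKernel ρ b x y = 0 := by
  have hρx : ContDiff ℝ 1 fun y => ρ (y - x) := h.contDiff_one.comp (contDiff_id.sub contDiff_const)
  have hbx : ContDiff ℝ 1 fun y => b y - b x := hb.sub contDiff_const
  have hc : HasCompactSupport fun y => ρ (y - x) • (b y - b x) :=
    HasCompactSupport.intro (isCompact_closedBall x ε) fun y hy => by
      rw [h.eq_zero_of_le _ (not_le.1 fun hyx => hy (mem_closedBall_iff_norm.2 hyx)).le, zero_smul]
  rw [← integral_divergence_eq_zero (F := fun y => ρ (y - x) • (b y - b x)) (hρx.smul hbx) hc]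
  congr 1 with y
  rw [divergence_smul (hρx.differentiable one_ne_zero y) (hbx.differentiable one_ne_zero y),
    fderiv_comp_sub, divergence_sub_const, commKernel, h.fderiv_sub_comm, h.sub_comm,
    neg_apply, ← map_neg, neg_sub]

theorem divergence_mollify_smul (h : IsMollifier A ε ρ) (hb : ContDiff ℝ 1 b)
    (hg : Integrable g) (y : E n) :
    divergence (fun y => mollify ρ g y • b y) y =
      ∫ x, g x * (commKernel ρ b x y - fderiv ℝ ρ (x - y) (b x)) := by
  have hρ := h.contDiff_one.continuous_fderiv one_ne_zero
  have hderiv : Integrable fun x => g x * fderiv ℝ ρ (y - x) (b y) :=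
    hg.mul_bdd (Continuous.aestronglyMeasurable (by fun_prop)) (Eventually.of_forall fun x =>
      (fderiv ℝ ρ (y - x)).le_of_opNorm_le (h.norm_fderiv_le _) (b y))
  have hmollify : DifferentiableAt ℝ (mollify ρ g) y :=
    (h.contDiff_mollify hg).differentiable (by simp) y
  rw [divergence_smul hmollify (hb.differentiable one_ne_zero y), h.fderiv_mollify hg,
    mollify_apply, ← integral_mul_const,
    ← integral_add hderiv ((h.integrable_mul_comp_sub hg y).mul_const _)]
  congr 1 with x
  rw [commKernel, h.fderiv_sub_comm y x, h.sub_comm y x, map_sub, neg_apply]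
  ring

theorem integral_mul_divergence_mollify_smul (h : IsMollifier A ε ρ) (hb : ContDiff ℝ 1 b)
    (hbc : HasCompactSupport b) {B : ℝ} (hB : ∀ x y, |commKernel ρ b x y| ≤ B)
    (hv : Integrable v) (hg : Integrable g) :
    ∫ y, v y * divergence (fun y => mollify ρ g y • b y) y =
      (∫ x, g x * ∫ y, v y * commKernel ρ b x y) -
        ∫ x, g x * fderiv ℝ (mollify ρ v) x (b x) := by
  have hρ := h.contDiff_one.continuous_fderiv one_ne_zero
  have hbcont := hb.continuous
  obtain ⟨β, hβ⟩ := hbcont.bounded_above_of_compact_support hbc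
  have hcomm : Integrable (fun q : E n × E n => g q.1 * (v q.2 * commKernel ρ b q.1 q.2))
      (volume.prod volume) :=
    integrable_mul_mul_of_bdd hg hv (continuous_commKernel h hb) fun q => hB _ _
  have htransport : Integrable
      (fun q : E n × E n => g q.1 * (v q.2 * fderiv ℝ ρ (q.1 - q.2) (b q.1)))
      (volume.prod volume) :=
    integrable_mul_mul_of_bdd hg hv (by fun_prop) fun q =>
      (fderiv ℝ ρ (q.1 - q.2)).le_of_opNorm_le_of_le (h.norm_fderiv_le _) (hβ _)
  calc ∫ y, v y * divergence (fun y => mollify ρ g y • b y) y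
      = ∫ y, ∫ x, (g x * (v y * commKernel ρ b x y) -
          g x * (v y * fderiv ℝ ρ (x - y) (b x))) := by
        simp_rw [divergence_mollify_smul h hb hg, ← integral_const_mul]
        congr! 4
        ring
    _ = ∫ x, ∫ y, (g x * (v y * commKernel ρ b x y) -
          g x * (v y * fderiv ℝ ρ (x - y) (b x))) :=
        (integral_integral_swap (hcomm.sub htransport)).symm
    _ = (∫ x, g x * ∫ y, v y * commKernel ρ b x y) -
          ∫ x, g x * fderiv ℝ (mollify ρ v) x (b x) := by
        rw [integral_integral_sub hcomm htransport]
        simp_rw [integral_const_mul, h.fderiv_mollify hv]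

theorem integral_mul_commKernel (h : IsMollifier A ε ρ) (hb : ContDiff ℝ 1 b) {B : ℝ}
    (hB : ∀ x y, |commKernel ρ b x y| ≤ B) (hv : Integrable v) (x : E n) :
    ∫ y, v y * commKernel ρ b x y = ∫ y, (v y - v x) * commKernel ρ b x y := by
  have hcont : Continuous fun y => commKernel ρ b x y :=
    (continuous_commKernel h hb).comp (.prodMk_right x)
  have hself : Integrable fun y => commKernel ρ b x y :=
    hcont.integrable_of_hasCompactSupport (HasCompactSupport.intro (isCompact_closedBall x ε)
      fun y hy => commKernel_eq_zero_of_le h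
        (not_le.1 fun hyx => hy (mem_closedBall_iff_norm'.2 hyx)).le)
  simp_rw [sub_mul]
  rw [integral_sub (hv.mul_bdd hcont.aestronglyMeasurable (Eventually.of_forall (hB x)))
    (hself.const_mul _), integral_const_mul, integral_commKernel h hb, mul_zero, sub_zero]

end Commutator

section WeakMaximumPrinciple

variable {n : ℕ} {s : ℝ} {b b' : E n → E n} {c u v : E n → ℝ} {Ω Ω' : TopologicalSpace.Opens (E n)}

theorem pairing_eq_integral (s : ℝ) (b : E n → E n) (c u : E n → ℝ) (φ : TestFunction Ω ℝ ⊤) :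
    pairing s b c u φ = (∫ x, u x * fracLaplacian s φ x)
      - (∫ x, u x * divergence (fun y => φ y • b y) x) + ∫ x, c x * u x * φ x := by
  rw [pairing, setIntegral_eq_integral_of_forall_compl_eq_zero,
    setIntegral_eq_integral_of_forall_compl_eq_zero] <;> intro x hx
  · have hφx : φ x = 0 := image_eq_zero_of_notMem_tsupport fun h => hx (φ.tsupport_subset h)
    rw [hφx, mul_zero]
  · rw [divergence_eq_zero_of_notMem_tsupport fun h =>
      hx (φ.tsupport_subset (tsupport_smul_subset_left φ b h)), mul_zero]

namespace IsSupersolution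

theorem nonneg_of_tsupport_subset (h : IsSupersolution s b c u Ω) {Φ : E n → ℝ}
    (hΦ : ContDiff ℝ (⊤ : ℕ∞) Φ) (hΦc : HasCompactSupport Φ) (hts : tsupport Φ ⊆ Ω)
    (hΦ0 : ∀ x, 0 ≤ Φ x) :
    0 ≤ (∫ x, u x * fracLaplacian s Φ x) - (∫ x, u x * divergence (fun y => Φ y • b y) x)
      + ∫ x, c x * u x * Φ x :=
  (h ⟨Φ, hΦ, hΦc, hts⟩ hΦ0).trans_eq (pairing_eq_integral s b c u _)

theorem mono (h : IsSupersolution s b c u Ω) (hΩ : Ω' ≤ Ω) : IsSupersolution s b c u Ω' :=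
  fun φ hφ => (h.nonneg_of_tsupport_subset φ.contDiff φ.hasCompactSupport
    (φ.tsupport_subset.trans hΩ) hφ).trans_eq (pairing_eq_integral s b c u φ).symm

theorem congr_drift (h : IsSupersolution s b c u Ω) (hb : Set.EqOn b b' Ω) :
    IsSupersolution s b' c u Ω := by
  intro φ hφ
  have hdiv : ∀ x ∈ Ω, u x * divergence (fun y => φ y • b' y) x =
      u x * divergence (fun y => φ y • b y) x := fun x hx => by
    rw [divergence_congr (F := fun y => φ y • b' y) (G := fun y => φ y • b y)]
    filter_upwards [Ω.isOpen.mem_nhds hx] with y hy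
    rw [hb hy]
  rw [pairing, setIntegral_congr_fun Ω.isOpen.measurableSet hdiv]
  exact h φ hφ

end IsSupersolution

theorem notMem_ball_of_mem_ball {x y x₀ : E n} {R ε : ℝ} (hx : x ∉ Metric.ball x₀ (R + ε))
    (hy : y ∈ Metric.ball x ε) : y ∉ Metric.ball x₀ R := fun hyb =>
  hx (by
    rw [Metric.mem_ball] at hy hyb ⊢
    linarith [dist_triangle_left x x₀ y])

theorem tsupport_subset_closedBall {f : E n → ℝ} {x₀ : E n} {R : ℝ}
    (hf : ∀ x, x ∉ Metric.ball x₀ R → f x = 0) : tsupport f ⊆ Metric.closedBall x₀ R :=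
  closure_minimal (fun _ hx => Metric.ball_subset_closedBall (not_imp_comm.1 (hf _) hx))
    Metric.isClosed_closedBall

theorem mul_negPart_eq_neg_sq (a : ℝ) : a * a⁻ = -a⁻ ^ 2 := by
  rcases le_total 0 a with ha | ha
  · simp [negPart_of_nonneg ha]
  · rw [negPart_of_nonpos ha]
    ring

theorem abs_negPart_sub_negPart_le (a c : ℝ) : |a⁻ - c⁻| ≤ |a - c| := by
  simpa only [negPart_def, abs_sub_comm a c, neg_sub_neg] using
    abs_max_sub_max_le_abs (-a) (-c) 0

section Mollified

variable {A ε : ℝ} {ρ : E n → ℝ} {x₀ : E n} {R₁ R₂ k : ℝ}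

theorem IsMollifier.negPart_mollify_eq_zero (h : IsMollifier A ε ρ) (hv : Integrable v)
    (hv0 : ∀ᵐ x, x ∉ Metric.ball x₀ R₁ → 0 ≤ v x) {x : E n} (hx : x ∉ Metric.ball x₀ (R₁ + ε)) :
    (mollify ρ v x)⁻ = 0 :=
  negPart_eq_zero.2 (h.le_mollify hv (hv0.mono fun _ hy hyx => hy (notMem_ball_of_mem_ball hx hyx)))

theorem IsMollifier.negPart_mollify_le (h : IsMollifier A ε ρ) (hv : Integrable v) (hk : 0 ≤ k)
    (hvk : ∀ᵐ x, -k ≤ v x) (x : E n) : (mollify ρ v x)⁻ ≤ k :=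
  sup_le (neg_le.1 (h.le_mollify hv (hvk.mono fun _ hy _ => hy))) hk

theorem IsMollifier.lintegral_sq_negPart_le (h : IsMollifier A ε ρ) (hv : Integrable v)
    (hk : 0 ≤ k) (hvk : ∀ᵐ x, -k ≤ v x) :
    ∫⁻ x, ENNReal.ofReal ((v x)⁻ ^ 2) ≤ (∫⁻ x, ENNReal.ofReal ((mollify ρ v x)⁻ ^ 2)) +
      ENNReal.ofReal (2 * k) * ∫⁻ x, ‖mollify ρ v x - v x‖ₑ := by
  have hmeas : AEMeasurable fun x => ENNReal.ofReal ((mollify ρ v x)⁻ ^ 2) :=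
    ((continuous_negPart.comp (h.contDiff_mollify hv).continuous).pow
      2).measurable.ennreal_ofReal.aemeasurable
  rw [← lintegral_const_mul' _ _ ENNReal.ofReal_ne_top, ← lintegral_add_left' hmeas]
  refine lintegral_mono_ae ?_
  filter_upwards [hvk] with x hx
  rw [Real.enorm_eq_ofReal_abs, ← ENNReal.ofReal_mul (by positivity),
    ← ENNReal.ofReal_add (sq_nonneg _) (by positivity)]
  refine ENNReal.ofReal_le_ofReal ?_
  have hv_le : (v x)⁻ ≤ k := sup_le (neg_le.1 hx) hk
  have hw_le := h.negPart_mollify_le hv hk hvk x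
  have hdiff : (v x)⁻ - (mollify ρ v x)⁻ ≤ |mollify ρ v x - v x| :=
    (le_abs_self _).trans ((abs_negPart_sub_negPart_le _ _).trans_eq (abs_sub_comm _ _))
  nlinarith [negPart_nonneg (v x), negPart_nonneg (mollify ρ v x), abs_nonneg (mollify ρ v x - v x)]

theorem IsMollifier.tsupport_mollify_subset (h : IsMollifier A ε ρ) {f : E n → ℝ}
    (hf : ∀ x, x ∉ Metric.ball x₀ R₁ → f x = 0) :
    tsupport (mollify ρ f) ⊆ Metric.closedBall x₀ (R₁ + ε) :=
  tsupport_subset_closedBall fun _ hx =>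
    h.mollify_eq_zero fun y hy => hf y (notMem_ball_of_mem_ball hx hy)

end Mollified

theorem integral_sq_half_mul_divergence_le {g : E n → ℝ} (hg : Continuous g)
    (hgc : HasCompactSupport g) (hb : ContDiff ℝ 1 b) {κ : ℝ}
    (hdiv : ∀ x, g x ≠ 0 → divergence b x ≤ 2 * κ) :
    ∫ x, g x ^ 2 / 2 * divergence b x ≤ κ * ∫ x, g x ^ 2 := by
  have hg2 : HasCompactSupport fun x => g x ^ 2 :=
    hgc.mono fun x hx h => hx (by simp only [h, zero_pow two_ne_zero])
  have hdivg : Continuous fun x => g x ^ 2 / 2 * divergence b x :=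
    ((hg.pow 2).div_const 2).mul (continuous_divergence hb)
  have hdivgc : HasCompactSupport fun x => g x ^ 2 / 2 * divergence b x :=
    hg2.mono fun x hx h => hx (by simp only [h, zero_div, zero_mul])
  rw [← integral_const_mul]
  refine integral_mono (hdivg.integrable_of_hasCompactSupport hdivgc)
    (((hg.pow 2).integrable_of_hasCompactSupport hg2).const_mul _) fun x => ?_
  by_cases hx : g x = 0
  · simp [hx]
  · linarith [mul_le_mul_of_nonneg_left (hdiv x hx) (by positivity : 0 ≤ g x ^ 2 / 2)]

-- Test the inequality with `ρ ⋆ (ρ ⋆ v)⁻`: evenness of `ρ` moves one mollifier onto `v`.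
theorem IsSupersolution.mul_integral_sq_negPart_mollify_le (hs0 : 0 < s) (hs1 : s < 1)
    {N μ : ℝ} {x₀ : E n} {R₁ R₂ : ℝ}
    (hsup : IsSupersolution s b (fun _ => N) v (openBall x₀ R₂)) (hv : Integrable v)
    (hv0 : ∀ᵐ x, x ∉ Metric.ball x₀ R₁ → 0 ≤ v x) (hb : ContDiff ℝ 1 b)
    (hbc : HasCompactSupport b)
    (hdiv : ∀ x ∈ Metric.ball x₀ R₂, divergence b x ≤ 2 * (N - μ)) {A ε : ℝ} {ρ : E n → ℝ}
    (h : IsMollifier A ε ρ) (hε : 0 < ε) (hεR : R₁ + ε + ε < R₂) {B : ℝ}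
    (hB : ∀ x y, |commKernel ρ b x y| ≤ B) :
    μ * ∫ x, (mollify ρ v x)⁻ ^ 2 ≤
      -∫ x, (mollify ρ v x)⁻ * ∫ y, v y * commKernel ρ b x y := by
  set g : E n → ℝ := fun x => (mollify ρ v x)⁻
  have hw := h.contDiff_mollify hv
  have hg : Continuous g := continuous_negPart.comp hw.continuous
  have hg0 (x : E n) (hx : x ∉ Metric.ball x₀ (R₁ + ε)) : g x = 0 :=
    h.negPart_mollify_eq_zero hv hv0 hx
  have hgc : HasCompactSupport g :=
    (isCompact_closedBall _ _).of_isClosed_subset (isClosed_tsupport g)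
      (tsupport_subset_closedBall hg0)
  have hgi : Integrable g := hg.integrable_of_hasCompactSupport hgc
  have hts : tsupport (mollify ρ g) ⊆ Metric.closedBall x₀ (R₁ + ε + ε) :=
    h.tsupport_mollify_subset hg0
  have hΦc : HasCompactSupport (mollify ρ g) :=
    (isCompact_closedBall _ _).of_isClosed_subset (isClosed_tsupport _) hts
  have tested := hsup.nonneg_of_tsupport_subset (h.contDiff_mollify hgi) hΦc
    (hts.trans (Metric.closedBall_subset_ball hεR)) (h.mollify_nonneg fun x => negPart_nonneg _)
  have energy : ∫ x, v x * fracLaplacian s (mollify ρ g) x ≤ 0 :=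
    integral_mul_fracLaplacian_mollify_negPart_nonpos hs0 hs1 h hv hgc hΦc
  have transport : ∫ x, g x * fderiv ℝ (mollify ρ v) x (b x) ≤ (N - μ) * ∫ x, g x ^ 2 := by
    rw [integral_negPart_mul_fderiv (hw.of_le (by exact_mod_cast le_top)) hb hbc]
    refine integral_sq_half_mul_divergence_le hg hgc hb fun x hx => hdiv x ?_
    exact Metric.ball_subset_ball (by linarith) (not_imp_comm.1 (hg0 x) hx)
  have zeroth_order : ∫ x, N * v x * mollify ρ g x = -(N * ∫ x, g x ^ 2) := by
    simp_rw [mul_assoc, integral_const_mul, h.integral_mul_mollify hv hgi, g,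
      mul_negPart_eq_neg_sq, integral_neg, mul_neg]
  rw [integral_mul_divergence_mollify_smul h hb hbc hB hv hgi, zeroth_order] at tested
  linarith

end WeakMaximumPrinciple

section WeakMaximumPrincipleLimit

variable {n : ℕ} {s : ℝ} {b : E n → E n} {v : E n → ℝ} {N μ k : ℝ} {x₀ : E n} {R₁ R₂ : ℝ}

theorem IsMollifier.lintegral_sq_negPart_mollify_le_of_integral_le {A ε : ℝ} {ρ : E n → ℝ}
    (h : IsMollifier A ε ρ) (hv : Integrable v) (hk : 0 ≤ k) (hvk : ∀ᵐ x, -k ≤ v x) (hμ : 0 ≤ μ)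
    (hgc : HasCompactSupport fun x => (mollify ρ v x)⁻) {f : E n → ℝ}
    (henergy : μ * ∫ x, (mollify ρ v x)⁻ ^ 2 ≤ -∫ x, (mollify ρ v x)⁻ * f x) :
    ENNReal.ofReal μ * ∫⁻ x, ENNReal.ofReal ((mollify ρ v x)⁻ ^ 2) ≤
      ENNReal.ofReal k * ∫⁻ x, ‖f x‖ₑ := by
  have hg : Continuous fun x => (mollify ρ v x)⁻ :=
    continuous_negPart.comp (h.contDiff_mollify hv).continuous
  have hg2 : Integrable fun x => (mollify ρ v x)⁻ ^ 2 :=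
    (hg.pow 2).integrable_of_hasCompactSupport
      (hgc.mono fun x hx (h : (mollify ρ v x)⁻ = 0) => hx (by simp [h]))
  calc ENNReal.ofReal μ * ∫⁻ x, ENNReal.ofReal ((mollify ρ v x)⁻ ^ 2)
      = ENNReal.ofReal (μ * ∫ x, (mollify ρ v x)⁻ ^ 2) := by
        rw [ENNReal.ofReal_mul hμ,
          ofReal_integral_eq_lintegral_ofReal hg2 (Eventually.of_forall fun _ => sq_nonneg _)]
    _ ≤ ‖∫ x, (mollify ρ v x)⁻ * f x‖ₑ := by
        rw [Real.enorm_eq_ofReal_abs]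
        exact ENNReal.ofReal_le_ofReal (henergy.trans (neg_le_abs _))
    _ ≤ ∫⁻ x, ENNReal.ofReal k * ‖f x‖ₑ := by
        refine (enorm_integral_le_lintegral_enorm _).trans (lintegral_mono fun x => ?_)
        rw [enorm_mul, Real.enorm_eq_ofReal (negPart_nonneg _)]
        gcongr
        exact h.negPart_mollify_le hv hk hvk x
    _ = ENNReal.ofReal k * ∫⁻ x, ‖f x‖ₑ := lintegral_const_mul' _ _ ENNReal.ofReal_ne_top

theorem IsSupersolution.exists_mul_lintegral_sq_negPart_le (hs0 : 0 < s) (hs1 : s < 1)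
    (hsup : IsSupersolution s b (fun _ => N) v (openBall x₀ R₂)) (hv : Integrable v)
    (hk : 0 ≤ k) (hvk : ∀ᵐ x, -k ≤ v x) (hR : R₁ < R₂)
    (hv0 : ∀ᵐ x, x ∉ Metric.ball x₀ R₁ → 0 ≤ v x) (hb : ContDiff ℝ 1 b)
    (hbc : HasCompactSupport b) (hμ : 0 ≤ μ)
    (hdiv : ∀ x ∈ Metric.ball x₀ R₂, divergence b x ≤ 2 * (N - μ)) :
    ∃ C : ENNReal, C ≠ ⊤ ∧ ∀ δ : ENNReal, δ ≠ 0 →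
      ENNReal.ofReal μ * ∫⁻ x, ENNReal.ofReal ((v x)⁻ ^ 2) ≤ C * δ := by
  obtain ⟨A, hA⟩ := exists_isMollifier (E n)
  obtain ⟨L, hL⟩ := hb.lipschitzWith_of_hasCompactSupport hbc one_ne_zero
  obtain ⟨D, hD⟩ := (continuous_divergence hb).bounded_above_of_compact_support
    (hasCompactSupport_divergence hbc)
  refine ⟨ENNReal.ofReal k * ENNReal.ofReal (A * (L + D)) +
    ENNReal.ofReal μ * (ENNReal.ofReal (2 * k) * ENNReal.ofReal A), by finiteness, fun δ hδ => ?_⟩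
  obtain ⟨ε, hosc, hε, hεR⟩ := ((eventually_lintegral_enorm_integral_sub_mul_le hv hδ).and
    (eventually_mem_set.2 (Ioo_mem_nhdsGT (half_pos (sub_pos.2 hR))))).exists
  obtain ⟨ρ, h⟩ := hA ε hε
  have hkernel := abs_commKernel_le h hε hL hD
  have commutator_small : ∫⁻ x, ‖∫ y, v y * commKernel ρ b x y‖ₑ ≤
      ENNReal.ofReal (A * (L + D)) * δ := by
    simp_rw [integral_mul_commKernel h hb hkernel hv]
    exact hosc _ _ hkernel fun x y => commKernel_eq_zero_of_le h
  have mollify_close : ∫⁻ x, ‖mollify ρ v x - v x‖ₑ ≤ ENNReal.ofReal A * δ := by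
    simp_rw [h.mollify_sub hv]
    exact hosc _ _ (fun x y => h.abs_le _) fun x y => h.eq_zero_of_le _
  have energy := hsup.mul_integral_sq_negPart_mollify_le hs0 hs1 hv hv0 hb hbc hdiv h hε
    (by linarith) hkernel
  have hgc : HasCompactSupport fun x => (mollify ρ v x)⁻ :=
    (isCompact_closedBall _ _).of_isClosed_subset (isClosed_tsupport _)
      (tsupport_subset_closedBall fun x => h.negPart_mollify_eq_zero hv hv0)
  calc ENNReal.ofReal μ * ∫⁻ x, ENNReal.ofReal ((v x)⁻ ^ 2)
      ≤ ENNReal.ofReal k * (∫⁻ x, ‖∫ y, v y * commKernel ρ b x y‖ₑ) +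
          ENNReal.ofReal μ * (ENNReal.ofReal (2 * k) * ∫⁻ x, ‖mollify ρ v x - v x‖ₑ) := by
        refine (mul_le_mul_right (h.lintegral_sq_negPart_le hv hk hvk) _).trans ?_
        rw [mul_add]
        refine add_le_add_left ?_ _
        exact h.lintegral_sq_negPart_mollify_le_of_integral_le hv hk hvk hμ hgc energy
    _ ≤ ENNReal.ofReal k * (ENNReal.ofReal (A * (L + D)) * δ) +
          ENNReal.ofReal μ * (ENNReal.ofReal (2 * k) * (ENNReal.ofReal A * δ)) := by
        gcongr
    _ = _ := by ring

theorem contDiff_smul_of_tsupport_subset {χ : E n → ℝ} {U : Set (E n)} (hχ : ContDiff ℝ 1 χ)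
    (hU : IsOpen U) (hb : ContDiffOn ℝ 1 b U) (hχU : tsupport χ ⊆ U) :
    ContDiff ℝ 1 fun x => χ x • b x := by
  refine contDiff_iff_contDiffAt.2 fun x => ?_
  by_cases hx : x ∈ tsupport fun x => χ x • b x
  · exact hχ.contDiffAt.smul
      (hb.contDiffAt (hU.mem_nhds (hχU (tsupport_smul_subset_left χ b hx))))
  · exact contDiffAt_const.congr_of_eventuallyEq (notMem_tsupport_iff_eventuallyEq.1 hx)

theorem exists_contDiff_hasCompactSupport_eqOn (hR₁ : 0 < R₁) (hR : R₁ < R₂)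
    (hb : ContDiffOn ℝ 1 b (Metric.ball x₀ R₂)) :
    ∃ b' : E n → E n, ContDiff ℝ 1 b' ∧ HasCompactSupport b' ∧
      Set.EqOn b b' (Metric.ball x₀ R₁) := by
  obtain ⟨R, hR₁R, hRR₂⟩ := exists_between hR
  let χ : ContDiffBump x₀ := ⟨R₁, R, hR₁, hR₁R⟩
  refine ⟨fun x => χ x • b x, ?_, χ.hasCompactSupport.smul_right, fun x hx => ?_⟩
  · exact contDiff_smul_of_tsupport_subset χ.contDiff Metric.isOpen_ball hb
      (χ.tsupport_eq ▸ Metric.closedBall_subset_ball hRR₂)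
  · simp [χ.one_of_mem_closedBall (Metric.ball_subset_closedBall hx)]

theorem IsSupersolution.ae_nonneg (hs0 : 0 < s) (hs1 : s < 1)
    (hsup : IsSupersolution s b (fun _ => N) v (openBall x₀ R₂)) (hv : Integrable v)
    (hk : 0 ≤ k) (hvk : ∀ᵐ x, -k ≤ v x) (hR₁ : 0 < R₁) (hR : R₁ < R₂)
    (hv0 : ∀ᵐ x, x ∉ Metric.ball x₀ R₁ → 0 ≤ v x)
    (hb : ContDiffOn ℝ 1 b (Metric.ball x₀ R₂)) (hμ : 0 < μ)
    (hdiv : ∀ x ∈ Metric.ball x₀ R₂, divergence b x ≤ 2 * (N - μ)) :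
    ∀ᵐ x, 0 ≤ v x := by
  obtain ⟨R, hR₁R, hRR₂⟩ := exists_between hR
  obtain ⟨b', hb', hbc', hbb'⟩ := exists_contDiff_hasCompactSupport_eqOn (hR₁.trans hR₁R) hRR₂ hb
  have hsub : Metric.ball x₀ R ⊆ Metric.ball x₀ R₂ := Metric.ball_subset_ball hRR₂.le
  have hdiv' (x : E n) (hx : x ∈ Metric.ball x₀ R) : divergence b' x ≤ 2 * (N - μ) :=
    (divergence_congr (hbb'.eventuallyEq_of_mem (Metric.isOpen_ball.mem_nhds hx))).symm.trans_le
      (hdiv x (hsub hx))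
  have hsup' : IsSupersolution s b' (fun _ => N) v (openBall x₀ R) :=
    (hsup.mono (Ω' := openBall x₀ R) hsub).congr_drift hbb'
  obtain ⟨C, hC, hsmall⟩ :=
    hsup'.exists_mul_lintegral_sq_negPart_le hs0 hs1 hv hk hvk hR₁R hv0 hb' hbc' hμ.le hdiv'
  have hzero : ∫⁻ x, ENNReal.ofReal ((v x)⁻ ^ 2) = 0 := by
    refine (mul_eq_zero.1 ?_).resolve_left (ENNReal.ofReal_pos.2 hμ).ne'
    by_contra hne
    obtain ⟨δ, hδ0, hδ⟩ := ENNReal.exists_nnreal_pos_mul_lt hC hne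
    exact absurd (hsmall δ (by simpa using hδ0.ne')) (not_le.2 (mul_comm C δ ▸ hδ))
  have hmeas : AEMeasurable fun x => ENNReal.ofReal ((v x)⁻ ^ 2) :=
    ((continuous_negPart.measurable.comp_aemeasurable
      hv.aestronglyMeasurable.aemeasurable).pow_const 2).ennreal_ofReal
  filter_upwards [(lintegral_eq_zero_iff' hmeas).1 hzero] with x hx
  have hsq : (v x)⁻ ^ 2 ≤ 0 := ENNReal.ofReal_eq_zero.1 hx
  exact negPart_eq_zero.1 (pow_eq_zero_iff two_ne_zero |>.1 (hsq.antisymm (sq_nonneg _)))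

end WeakMaximumPrincipleLimit

section KernelTail

variable {n : ℕ} {s : ℝ}

/-- The mass of the kernel `|z|^{-n-2s}` outside the closed ball of radius `ρ`; it controls what the
fractional Laplacian sees of a function at distance more than `ρ`. -/
def kernelTail (n : ℕ) (s ρ : ℝ) : ℝ :=
  ∫ z in (Metric.closedBall (0 : E n) ρ)ᶜ, 1 / ‖z‖ ^ ((n : ℝ) + 2 * s)

theorem kernelTail_nonneg (n : ℕ) (s ρ : ℝ) : 0 ≤ kernelTail n s ρ :=
  integral_nonneg fun z => by positivity

open scoped Pointwise in
theorem kernelTail_mul {r : ℝ} (hr : 0 < r) (ρ : ℝ) :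
    kernelTail n s (r * ρ) = r ^ (-(2 * s)) * kernelTail n s ρ := by
  have hset : r • (Metric.closedBall (0 : E n) ρ)ᶜ = (Metric.closedBall 0 (r * ρ))ᶜ := by
    rw [Set.compl_eq_univ_sdiff, Set.smul_set_sdiff₀ hr.ne', Set.smul_set_univ₀ hr.ne',
      smul_closedBall' hr.ne', smul_zero, Real.norm_of_nonneg hr.le, Set.compl_eq_univ_sdiff]
  have hpow : r ^ n * (r ^ ((n : ℝ) + 2 * s))⁻¹ = r ^ (-(2 * s)) := by
    rw [← Real.rpow_natCast, ← Real.rpow_neg hr.le, ← Real.rpow_add hr]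
    ring_nf
  have hscale := Measure.setIntegral_comp_smul_of_pos volume
    (fun z : E n => 1 / ‖z‖ ^ ((n : ℝ) + 2 * s)) (Metric.closedBall 0 ρ)ᶜ hr
  simp only [norm_smul, Real.norm_of_nonneg hr.le, Real.mul_rpow hr.le (norm_nonneg _),
    one_div, mul_inv, hset, finrank_euclideanSpace_fin, smul_eq_mul, integral_const_mul] at hscale
  simp only [kernelTail, one_div]
  rw [← hpow, mul_assoc, hscale, mul_inv_cancel_left₀ (by positivity)]

theorem measureReal_ball_sdiff_ball {F : Type*} [NormedAddCommGroup F] [NormedSpace ℝ F]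
    [FiniteDimensional ℝ F] [MeasurableSpace F] [BorelSpace F] (μ : Measure F)
    [μ.IsAddHaarMeasure] (x : F) {r θ : ℝ} (hr : 0 < r) (hθ0 : 0 < θ) (hθ1 : θ ≤ 1) :
    μ.real (Metric.ball x r \ Metric.ball x (θ * r)) =
      r ^ Module.finrank ℝ F * ((1 - θ ^ Module.finrank ℝ F) * μ.real (Metric.ball 0 1)) := by
  have hball (t : ℝ) (ht : 0 < t) :
      μ.real (Metric.ball x t) = t ^ Module.finrank ℝ F * μ.real (Metric.ball 0 1) := by
    simp [measureReal_def, Measure.addHaar_ball_of_pos μ x ht, ht.le]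
  rw [measureReal_sdiff (Metric.ball_subset_ball (mul_le_of_le_one_left hr.le hθ1))
    measurableSet_ball measure_ball_lt_top.ne, hball r hr, hball _ (by positivity), mul_pow]
  ring

end KernelTail

section NearField

variable {F : Type*} [NormedAddCommGroup F] [MeasurableSpace F] [BorelSpace F] {μ : Measure F}
  [μ.IsAddRightInvariant] {Φ : F → ℝ}

theorem integrable_secondDiff (hΦ : Integrable Φ μ) (z : F) :
    Integrable (fun x => secondDiff Φ x z) μ :=
  ((hΦ.const_mul 2).sub (hΦ.comp_add_right z)).sub (hΦ.comp_sub_right z)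

theorem integral_secondDiff (hΦ : Integrable Φ μ) (z : F) : ∫ x, secondDiff Φ x z ∂μ = 0 := by
  have hsub : Integrable (fun x => 2 * Φ x - Φ (x + z)) μ :=
    (hΦ.const_mul 2).sub (hΦ.comp_add_right z)
  simp_rw [secondDiff]
  rw [integral_sub hsub (hΦ.comp_sub_right z), integral_sub (hΦ.const_mul 2) (hΦ.comp_add_right z),
    integral_const_mul, integral_add_right_eq_self, integral_sub_right_eq_self]
  ring

theorem setIntegral_ball_secondDiff_eq_zero (hΦ : Integrable Φ μ) {x₀ : F} {R₂ R₃ : ℝ}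
    (hΦR : ∀ x ∉ Metric.ball x₀ R₂, Φ x = 0) {z : F} (hz : ‖z‖ ≤ R₃ - R₂) :
    ∫ x in Metric.ball x₀ R₃, secondDiff Φ x z ∂μ = 0 := by
  rw [setIntegral_eq_integral_of_forall_compl_eq_zero fun x hx => ?_, integral_secondDiff hΦ]
  have hzero (w : F) (hw : ‖w‖ ≤ R₃ - R₂) : Φ (x + w) = 0 := hΦR _ fun hxw => hx <| by
    rw [mem_ball_iff_norm] at hxw ⊢
    calc ‖x - x₀‖ = ‖(x + w - x₀) - w‖ := by congr 1; abel
      _ ≤ ‖x + w - x₀‖ + ‖w‖ := norm_sub_le _ _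
      _ < R₃ := by linarith
  have hx0 : Φ x = 0 := by simpa using hzero 0 (by simpa using (norm_nonneg z).trans hz)
  rw [secondDiff, sub_eq_add_neg x, hx0, hzero z hz, hzero (-z) (by rwa [norm_neg])]
  ring

theorem setIntegral_secondDiff_le (hΦ : Integrable Φ μ) (hΦ0 : ∀ x, 0 ≤ Φ x) (S : Set F) (z : F) :
    ∫ x in S, secondDiff Φ x z ∂μ ≤ 2 * ∫ x, Φ x ∂μ :=
  calc ∫ x in S, secondDiff Φ x z ∂μ ≤ ∫ x in S, 2 * Φ x ∂μ :=
        integral_mono (integrable_secondDiff hΦ z).integrableOn (hΦ.const_mul 2).integrableOn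
          fun x => by
            rw [secondDiff]
            linarith [hΦ0 (x + z), hΦ0 (x - z)]
    _ ≤ ∫ x, 2 * Φ x ∂μ := setIntegral_le_integral (hΦ.const_mul 2)
        (Eventually.of_forall fun x => mul_nonneg zero_le_two (hΦ0 x))
    _ = 2 * ∫ x, Φ x ∂μ := integral_const_mul _ _

variable {n : ℕ} {s : ℝ} {Φ : E n → ℝ} {x₀ : E n} {R₂ R₃ : ℝ}

theorem setIntegral_fracLaplacian_le (hs0 : 0 < s) (hs1 : s < 1) (hΦ : ContDiff ℝ 2 Φ)
    (hΦc : HasCompactSupport Φ) (hΦ0 : ∀ x, 0 ≤ Φ x)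
    (hΦR : ∀ x ∉ Metric.ball x₀ R₂, Φ x = 0) (hR : R₂ < R₃) :
    ∫ x in Metric.ball x₀ R₃, fracLaplacian s Φ x ≤
      fracConst n s * ((∫ x, Φ x) * kernelTail n s (R₃ - R₂)) := by
  set S := Metric.ball x₀ R₃
  have hΦi : Integrable Φ := hΦ.continuous.integrable_of_hasCompactSupport hΦc
  have hS : Integrable (S.indicator fun _ => (1 : ℝ)) :=
    (integrable_indicator_iff measurableSet_ball).2 (integrableOn_const measure_ball_lt_top.ne)
  have indicator_mul (f : E n → ℝ) :
      ∫ x, S.indicator (fun _ => (1 : ℝ)) x * f x = ∫ x in S, f x := by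
    rw [← integral_indicator (f := f) measurableSet_ball]
    simp only [← Set.indicator_mul_left, one_mul]
    rfl
  have hz (z : E n) : (∫ x in S, secondDiff Φ x z) / ‖z‖ ^ ((n : ℝ) + 2 * s) ≤
      (Metric.closedBall 0 (R₃ - R₂))ᶜ.indicator
        (fun z => 2 * (∫ x, Φ x) * (1 / ‖z‖ ^ ((n : ℝ) + 2 * s))) z := by
    by_cases hz : z ∈ Metric.closedBall 0 (R₃ - R₂)
    · rw [Set.indicator_of_notMem (not_not.2 hz), setIntegral_ball_secondDiff_eq_zero hΦi hΦR
        (by simpa using hz), zero_div]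
    · rw [Set.indicator_of_mem hz, mul_one_div]
      gcongr
      exact setIntegral_secondDiff_le hΦi hΦ0 S z
  have hint := integrable_integral_mul_secondDiff_div_rpow hs0 hs1 hΦ hΦc hS
  have hcompl := (Metric.isClosed_closedBall (x := (0 : E n)) (ε := R₃ - R₂)).measurableSet.compl
  have tail_bound := integral_mono (by simpa only [indicator_mul] using hint)
    ((integrable_indicator_iff hcompl).2 ((integrableOn_one_div_rpow_compl_closedBall
      (finrank_lt_add_two_mul hs0) (sub_pos.2 hR)).const_mul (2 * ∫ x, Φ x))) hz
  rw [integral_indicator hcompl, integral_const_mul, ← kernelTail] at tail_bound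
  rw [← indicator_mul, integral_mul_fracLaplacian hs0 hs1 hΦ hΦc hS]
  simp_rw [indicator_mul]
  refine mul_le_mul_of_nonneg_left ?_ (fracConst_pos hs0 hs1).le
  linarith

end NearField

section FarField

theorem integrable_div_norm_sub_rpow_of_notMem_tsupport {F : Type*} [NormedAddCommGroup F]
    [MeasurableSpace F] [BorelSpace F] {μ : Measure F} [IsFiniteMeasureOnCompacts μ] {Φ : F → ℝ}
    (hΦ : Continuous Φ) (hΦc : HasCompactSupport Φ) {x : F} (hx : x ∉ tsupport Φ) (p : ℝ) :
    Integrable (fun y => Φ y / ‖x - y‖ ^ p) μ := by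
  have hsupp : Function.support (fun y => Φ y / ‖x - y‖ ^ p) ⊆ Function.support Φ :=
    fun y hy (h : Φ y = 0) => hy (by simp only [h, zero_div])
  refine Continuous.integrable_of_hasCompactSupport (continuous_of_tsupport fun y hy => ?_)
    (hΦc.mono hsupp)
  have hxy : ‖x - y‖ ≠ 0 :=
    norm_ne_zero_iff.2 (sub_ne_zero.2 fun h => hx (h ▸ closure_mono hsupp hy))
  exact hΦ.continuousAt.div ((by fun_prop : ContinuousAt (fun y => ‖x - y‖) y).rpow_const
    (Or.inl hxy)) (Real.rpow_pos_of_pos (hxy.symm.lt_of_le (norm_nonneg _)) p).ne'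

theorem one_add_norm_rpow_le {F : Type*} [NormedAddCommGroup F] {x y : F} {R p : ℝ} (hp : 0 ≤ p)
    (hy : ‖y‖ ≤ R) (hxy : 1 ≤ ‖x - y‖) :
    1 + ‖x‖ ^ p ≤ (1 + (1 + R) ^ p) * ‖x - y‖ ^ p := by
  have hR : 0 ≤ R := (norm_nonneg y).trans hy
  have hx : ‖x‖ ≤ (1 + R) * ‖x - y‖ :=
    calc ‖x‖ = ‖(x - y) + y‖ := by rw [sub_add_cancel]
      _ ≤ ‖x - y‖ + R := (norm_add_le _ _).trans (by gcongr)
      _ ≤ (1 + R) * ‖x - y‖ := by nlinarith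
  rw [add_mul, one_mul, ← Real.mul_rpow (by positivity) (norm_nonneg _)]
  gcongr
  exact Real.one_le_rpow hxy hp

variable {n : ℕ} {s : ℝ} {Φ : E n → ℝ}

theorem fracLaplacian_nonpos_of_notMem_tsupport (hs0 : 0 < s) (hs1 : s < 1) (hΦ0 : ∀ x, 0 ≤ Φ x)
    {x : E n} (hx : x ∉ tsupport Φ) : fracLaplacian s Φ x ≤ 0 := by
  rw [fracLaplacian_eq_of_notMem_tsupport hx, neg_nonpos]
  exact mul_nonneg (fracConst_pos hs0 hs1).le
    (integral_nonneg fun y => div_nonneg (hΦ0 y) (by positivity))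

theorem fracLaplacian_le_of_forall_norm_sub_le (hs0 : 0 < s) (hs1 : s < 1) (hΦ : Continuous Φ)
    (hΦc : HasCompactSupport Φ) (hΦ0 : ∀ x, 0 ≤ Φ x) {x : E n} (hx : x ∉ tsupport Φ) {D : ℝ}
    (hD : ∀ y ∈ tsupport Φ, ‖x - y‖ ≤ D) :
    fracLaplacian s Φ x ≤ -(fracConst n s * ((∫ y, Φ y) / D ^ ((n : ℝ) + 2 * s))) := by
  rw [fracLaplacian_eq_of_notMem_tsupport hx, neg_le_neg_iff, ← integral_div]
  refine mul_le_mul_of_nonneg_left (integral_mono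
    ((hΦ.integrable_of_hasCompactSupport hΦc).div_const _)
    (integrable_div_norm_sub_rpow_of_notMem_tsupport hΦ hΦc hx _) fun y => ?_)
    (fracConst_pos hs0 hs1).le
  by_cases hy : y ∈ tsupport Φ
  · have hxy : 0 < ‖x - y‖ := norm_pos_iff.2 (sub_ne_zero.2 fun h => hx (h ▸ hy))
    have := hΦ0 y
    gcongr
    exact hD y hy
  · simp [image_eq_zero_of_notMem_tsupport hy]

theorem exists_abs_fracLaplacian_le (hs0 : 0 < s) (hs1 : s < 1) (hΦ : ContDiff ℝ 2 Φ)
    (hΦc : HasCompactSupport Φ) : ∃ K, ∀ x, |fracLaplacian s Φ x| ≤ K := by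
  obtain ⟨K, hK⟩ := exists_abs_secondDiff_le hΦ hΦc
  refine ⟨|fracConst n s| * (2⁻¹ *
    ∫ z : E n, K * (min 1 (‖z‖ ^ 2) / ‖z‖ ^ ((n : ℝ) + 2 * s))), fun x => ?_⟩
  rw [fracLaplacian_eq hs0 hs1 hΦ hΦc, abs_mul, abs_mul, abs_of_pos (by norm_num : (0 : ℝ) < 2⁻¹)]
  gcongr
  have hdom := (integrable_min_one_sq_div_rpow (F := E n) (finrank_lt_add_two_mul hs0)
    (add_two_mul_lt_finrank_add_two hs1)).const_mul K
  refine abs_integral_le_integral_abs.trans (integral_mono_of_nonneg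
    (Eventually.of_forall fun z => abs_nonneg _) hdom (Eventually.of_forall fun z => ?_))
  beta_reduce
  rw [abs_div, abs_of_nonneg (by positivity : 0 ≤ ‖z‖ ^ ((n : ℝ) + 2 * s)), ← mul_div_assoc]
  gcongr
  exact hK x z

theorem abs_fracLaplacian_mul_one_add_norm_rpow_le (hs0 : 0 < s) (hΦ : Continuous Φ)
    (hΦc : HasCompactSupport Φ) {R : ℝ} (hR : ∀ y ∈ tsupport Φ, ‖y‖ ≤ R) {x : E n}
    (hx : R + 1 ≤ ‖x‖) :
    |fracLaplacian s Φ x| * (1 + ‖x‖ ^ ((n : ℝ) + 2 * s)) ≤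
      |fracConst n s| * ∫ y, |Φ y| * (1 + (1 + R) ^ ((n : ℝ) + 2 * s)) := by
  have hsub (y : E n) (hy : y ∈ tsupport Φ) : 1 ≤ ‖x - y‖ := by
    linarith [norm_sub_norm_le x y, hR y hy]
  have hxΦ : x ∉ tsupport Φ := fun h => by linarith [hR x h]
  rw [fracLaplacian_eq_of_notMem_tsupport hxΦ, abs_neg, abs_mul, mul_assoc]
  gcongr
  have hint := integrable_div_norm_sub_rpow_of_notMem_tsupport (μ := volume) hΦ hΦc hxΦ
    ((n : ℝ) + 2 * s)
  refine (mul_le_mul_of_nonneg_right abs_integral_le_integral_abs (by positivity)).trans ?_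
  rw [← integral_mul_const]
  refine integral_mono (hint.abs.mul_const _)
    ((hΦ.integrable_of_hasCompactSupport hΦc).abs.mul_const _) fun y => ?_
  by_cases hy : y ∈ tsupport Φ
  · have hxy : 0 < ‖x - y‖ := by linarith [hsub y hy]
    beta_reduce
    rw [abs_div, abs_of_nonneg (by positivity : 0 ≤ ‖x - y‖ ^ ((n : ℝ) + 2 * s)),
      div_mul_eq_mul_div, div_le_iff₀ (by positivity), mul_assoc]
    gcongr
    exact one_add_norm_rpow_le (by positivity) (hR y hy) (hsub y hy)
  · simp [image_eq_zero_of_notMem_tsupport hy]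

theorem exists_abs_fracLaplacian_mul_one_add_norm_rpow_le (hs0 : 0 < s) (hs1 : s < 1)
    (hΦ : ContDiff ℝ 2 Φ) (hΦc : HasCompactSupport Φ) :
    ∃ K, ∀ x, |fracLaplacian s Φ x * (1 + ‖x‖ ^ ((n : ℝ) + 2 * s))| ≤ K := by
  obtain ⟨K, hK⟩ := exists_abs_fracLaplacian_le hs0 hs1 hΦ hΦc
  obtain ⟨R, hR⟩ := hΦc.isBounded.exists_norm_le
  have hK0 : 0 ≤ K := (abs_nonneg _).trans (hK 0)
  refine ⟨max (K * (1 + (R + 1) ^ ((n : ℝ) + 2 * s)))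
    (|fracConst n s| * ∫ y, |Φ y| * (1 + (1 + R) ^ ((n : ℝ) + 2 * s))), fun x => ?_⟩
  rw [abs_mul, abs_of_nonneg (by positivity : 0 ≤ 1 + ‖x‖ ^ ((n : ℝ) + 2 * s))]
  rcases le_total ‖x‖ (R + 1) with hx | hx
  · refine le_max_of_le_left ?_
    gcongr
    exact hK x
  · exact le_max_of_le_right
      (abs_fracLaplacian_mul_one_add_norm_rpow_le hs0 hΦ.continuous hΦc hR hx)

theorem stronglyMeasurable_fracLaplacian (hs0 : 0 < s) (hs1 : s < 1) (hΦ : ContDiff ℝ 2 Φ)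
    (hΦc : HasCompactSupport Φ) : StronglyMeasurable (fracLaplacian s Φ) := by
  have hmeas : Measurable fun q : E n × E n => secondDiff Φ q.1 q.2 / ‖q.2‖ ^ ((n : ℝ) + 2 * s) :=
    (continuous_uncurry_secondDiff hΦ.continuous).measurable.div (by fun_prop)
  rw [funext (fracLaplacian_eq hs0 hs1 hΦ hΦc)]
  exact (hmeas.stronglyMeasurable.integral_prod_right'.const_mul _).const_mul _

theorem integrableOn_fracLaplacian (hs0 : 0 < s) (hs1 : s < 1) (hΦ : ContDiff ℝ 2 Φ)
    (hΦc : HasCompactSupport Φ) {S : Set (E n)} (hS : volume S ≠ ⊤) :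
    IntegrableOn (fracLaplacian s Φ) S := by
  obtain ⟨K, hK⟩ := exists_abs_fracLaplacian_le hs0 hs1 hΦ hΦc
  exact IntegrableOn.of_bound hS.lt_top
    (stronglyMeasurable_fracLaplacian hs0 hs1 hΦ hΦc).aestronglyMeasurable K
    (Eventually.of_forall hK)

theorem MemL.locallyIntegrable {u : E n → ℝ} {a : ℝ} (hu : MemL a u) (ha : 0 ≤ a) :
    LocallyIntegrable u := by
  have hcont : Continuous fun y : E n => 1 + ‖y‖ ^ ((n : ℝ) + a) :=
    continuous_const.add (continuous_norm.rpow_const fun _ => Or.inr (by positivity))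
  have hpos (y : E n) : 1 + ‖y‖ ^ ((n : ℝ) + a) ≠ 0 := by positivity
  simpa only [div_mul_cancel₀ _ (hpos _)] using
    (Integrable.locallyIntegrable hu).mul_continuous hcont

theorem MemL.integrable_mul_fracLaplacian {u : E n → ℝ} (hu : MemL (2 * s) u) (hs0 : 0 < s)
    (hs1 : s < 1) (hΦ : ContDiff ℝ 2 Φ) (hΦc : HasCompactSupport Φ) :
    Integrable fun x => u x * fracLaplacian s Φ x := by
  obtain ⟨K, hK⟩ := exists_abs_fracLaplacian_mul_one_add_norm_rpow_le hs0 hs1 hΦ hΦc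
  have hweight : Measurable fun x : E n => 1 + ‖x‖ ^ ((n : ℝ) + 2 * s) := by fun_prop
  refine (Integrable.mul_bdd hu
    ((stronglyMeasurable_fracLaplacian hs0 hs1 hΦ hΦc).aestronglyMeasurable.mul
      hweight.aestronglyMeasurable) (Eventually.of_forall hK)).congr
    (Eventually.of_forall fun x => ?_)
  have hpos : 1 + ‖x‖ ^ ((n : ℝ) + 2 * s) ≠ 0 := by positivity
  simp only [Pi.mul_apply]
  field_simp

theorem setIntegral_compl_mul_fracLaplacian_le (hs0 : 0 < s) (hs1 : s < 1)
    (hΦ : ContDiff ℝ 2 Φ) (hΦc : HasCompactSupport Φ) (hΦ0 : ∀ x, 0 ≤ Φ x) {S T : Set (E n)}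
    (hS : MeasurableSet S) (hΦS : tsupport Φ ⊆ S) (hT : MeasurableSet T) (hTS : T ⊆ Sᶜ)
    (hTfin : volume T ≠ ⊤) {D : ℝ} (hD : ∀ x ∈ T, ∀ y ∈ tsupport Φ, ‖x - y‖ ≤ D) {u : E n → ℝ}
    (hu : MemL (2 * s) u) (hu0 : ∀ᵐ x, 0 ≤ u x) {m : ℝ} (hm : 0 ≤ m)
    (hum : ∀ᵐ x, x ∈ T → m ≤ u x) :
    ∫ x in Sᶜ, u x * fracLaplacian s Φ x ≤
      -(fracConst n s * ((∫ y, Φ y) * (m * volume.real T / D ^ ((n : ℝ) + 2 * s)))) := by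
  set q := fracConst n s * ((∫ y, Φ y) / D ^ ((n : ℝ) + 2 * s)) with hq
  have hL0 (x : E n) (hx : x ∈ Sᶜ) : fracLaplacian s Φ x ≤ 0 :=
    fracLaplacian_nonpos_of_notMem_tsupport hs0 hs1 hΦ0 fun h => hx (hΦS h)
  have hLT (x : E n) (hx : x ∈ T) : fracLaplacian s Φ x ≤ -q :=
    fracLaplacian_le_of_forall_norm_sub_le hs0 hs1 hΦ.continuous hΦc hΦ0
      (fun h => hTS hx (hΦS h)) (hD x hx)
  calc ∫ x in Sᶜ, u x * fracLaplacian s Φ x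
      ≤ ∫ x in Sᶜ, T.indicator (fun _ => m * -q) x := by
        refine setIntegral_mono_ae_restrict
          (hu.integrable_mul_fracLaplacian hs0 hs1 hΦ hΦc).integrableOn
          ((integrable_indicator_iff hT).2 (integrableOn_const hTfin)).integrableOn
          ((ae_restrict_iff' hS.compl).2 ?_)
        filter_upwards [hu0, hum] with x hx hxm hxS
        by_cases hxT : x ∈ T
        · rw [Set.indicator_of_mem hxT]
          calc u x * fracLaplacian s Φ x ≤ m * fracLaplacian s Φ x :=
                mul_le_mul_of_nonpos_right (hxm hxT) (hL0 x hxS)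
            _ ≤ m * -q := mul_le_mul_of_nonneg_left (hLT x hxT) hm
        · rw [Set.indicator_of_notMem hxT]
          exact mul_nonpos_of_nonneg_of_nonpos hx (hL0 x hxS)
    _ = volume.real T * (m * -q) := by
        rw [setIntegral_indicator hT, Set.inter_eq_right.2 hTS, setIntegral_const, smul_eq_mul]
    _ = _ := by
        rw [hq]
        ring

end FarField

section Truncation

section Split

variable {α : Type*} [MeasurableSpace α] {μ : Measure α} {u f : α → ℝ} {S : Set α}

theorem integral_mul_eq_integral_indicator_sub_mul_add (hS : MeasurableSet S)
    (huf : Integrable (fun x => u x * f x) μ) (hf : IntegrableOn f S μ) (k : ℝ) :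
    ∫ x, u x * f x ∂μ = (∫ x, S.indicator (fun y => u y - k) x * f x ∂μ) +
      k * (∫ x in S, f x ∂μ) + ∫ x in Sᶜ, u x * f x ∂μ := by
  simp only [← Set.indicator_mul_left, sub_mul]
  rw [integral_indicator hS, integral_sub huf.integrableOn (hf.const_mul k), integral_const_mul,
    sub_add_cancel, integral_add_compl hS huf]

theorem integral_mul_eq_integral_indicator_sub_mul (hS : MeasurableSet S)
    (huf : Integrable (fun x => u x * f x) μ) (hf : Integrable f μ) (hfS : ∀ x ∉ S, f x = 0)
    (k : ℝ) :
    ∫ x, u x * f x ∂μ =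
      (∫ x, S.indicator (fun y => u y - k) x * f x ∂μ) + k * ∫ x, f x ∂μ := by
  rw [integral_mul_eq_integral_indicator_sub_mul_add hS huf hf.integrableOn k,
    setIntegral_eq_integral_of_forall_compl_eq_zero hfS,
    setIntegral_eq_zero_of_forall_eq_zero (t := Sᶜ) fun x hx => by rw [hfS x hx, mul_zero],
    add_zero]

end Split

variable {n : ℕ} {s : ℝ} {b : E n → E n} {c u Φ : E n → ℝ} {x₀ : E n} {R₂ R₃ r k m N : ℝ}

theorem integral_mul_fracLaplacian_le_integral_indicator_sub (hs0 : 0 < s) (hs1 : s < 1)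
    (hΦ : ContDiff ℝ 2 Φ) (hΦc : HasCompactSupport Φ) (hΦ0 : ∀ x, 0 ≤ Φ x)
    (hts : tsupport Φ ⊆ Metric.ball x₀ R₂) (hR : R₂ < R₃) (hRr : R₃ ≤ r)
    (hu : MemL (2 * s) u) (hu0 : ∀ᵐ x, 0 ≤ u x) (hm : 0 ≤ m)
    (hum : ∀ᵐ x, x ∈ Metric.ball x₀ r \ Metric.ball x₀ R₃ → m ≤ u x) (hk : 0 ≤ k) :
    ∫ x, u x * fracLaplacian s Φ x ≤
      (∫ x, (Metric.ball x₀ R₃).indicator (fun y => u y - k) x * fracLaplacian s Φ x) +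
        (∫ x, Φ x) * (k * (fracConst n s * kernelTail n s (R₃ - R₂)) -
          fracConst n s * (m * volume.real (Metric.ball x₀ r \ Metric.ball x₀ R₃) /
            (2 * r) ^ ((n : ℝ) + 2 * s))) := by
  have hdist (x : E n) (hx : x ∈ Metric.ball x₀ r \ Metric.ball x₀ R₃) (y : E n)
      (hy : y ∈ tsupport Φ) : ‖x - y‖ ≤ 2 * r := by
    have hxr := Metric.mem_ball.1 hx.1
    have hyr := Metric.mem_ball.1 (hts hy)
    rw [← dist_eq_norm]
    linarith [dist_triangle_right x y x₀]
  have near := mul_le_mul_of_nonneg_left (setIntegral_fracLaplacian_le hs0 hs1 hΦ hΦc hΦ0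
    (fun x hx => image_eq_zero_of_notMem_tsupport fun h => hx (hts h)) hR) hk
  have far := setIntegral_compl_mul_fracLaplacian_le hs0 hs1 hΦ hΦc hΦ0 measurableSet_ball
    (hts.trans (Metric.ball_subset_ball hR.le)) (measurableSet_ball.diff measurableSet_ball)
    (fun x hx => hx.2) (measure_ne_top_of_subset Set.sdiff_subset measure_ball_lt_top.ne) hdist
    hu hu0 hm hum
  rw [integral_mul_eq_integral_indicator_sub_mul_add (measurableSet_ball (x := x₀) (ε := R₃))
    (hu.integrable_mul_fracLaplacian hs0 hs1 hΦ hΦc)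
    (integrableOn_fracLaplacian hs0 hs1 hΦ hΦc measure_ball_lt_top.ne) k]
  linarith

theorem integral_mul_divergence_smul_eq_integral_indicator_sub {S U : Set (E n)}
    (hu : LocallyIntegrable u) (hΦ : ContDiff ℝ 1 Φ) (hΦc : HasCompactSupport Φ) (hU : IsOpen U)
    (hb : ContDiffOn ℝ 1 b U) (hΦU : tsupport Φ ⊆ U) (hS : MeasurableSet S)
    (hΦS : tsupport Φ ⊆ S) (k : ℝ) :
    ∫ x, u x * divergence (fun y => Φ y • b y) x =
      ∫ x, S.indicator (fun y => u y - k) x * divergence (fun y => Φ y • b y) x := by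
  have hF : ContDiff ℝ 1 fun y => Φ y • b y := contDiff_smul_of_tsupport_subset hΦ hU hb hΦU
  have hFc : HasCompactSupport fun y => Φ y • b y := hΦc.smul_right
  have hdiv := continuous_divergence hF
  have hdivc := hasCompactSupport_divergence hFc
  rw [integral_mul_eq_integral_indicator_sub_mul hS
      (hu.integrable_smul_right_of_hasCompactSupport hdiv hdivc)
      (hdiv.integrable_of_hasCompactSupport hdivc)
      (fun x hx => divergence_eq_zero_of_notMem_tsupport fun h =>
        hx (hΦS (tsupport_smul_subset_left Φ b h))) k,
    integral_divergence_eq_zero hF hFc, mul_zero, add_zero]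

theorem integral_mul_mul_le_integral_indicator_sub {S U : Set (E n)} (hu : LocallyIntegrable u)
    (hu0 : ∀ᵐ x, 0 ≤ u x) (hcu : LocallyIntegrableOn (fun x => c x * u x) U)
    (hcN : ∀ᵐ x, x ∈ U → c x ≤ N) (hΦ : Continuous Φ) (hΦc : HasCompactSupport Φ)
    (hΦ0 : ∀ x, 0 ≤ Φ x) (hΦU : tsupport Φ ⊆ U) (hS : MeasurableSet S) (hΦS : tsupport Φ ⊆ S)
    (k : ℝ) :
    ∫ x, c x * u x * Φ x ≤
      (∫ x, N * S.indicator (fun y => u y - k) x * Φ x) + N * (k * ∫ x, Φ x) := by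
  have hΦz {A : Set (E n)} (hA : tsupport Φ ⊆ A) (x : E n) (hx : x ∉ A) : Φ x = 0 :=
    image_eq_zero_of_notMem_tsupport fun h => hx (hA h)
  have huΦ : Integrable fun x => u x * Φ x := hu.integrable_smul_right_of_hasCompactSupport hΦ hΦc
  have hcuΦ : Integrable fun x => c x * u x * Φ x :=
    (integrableOn_iff_integrable_of_support_subset fun x hx => by
      by_contra h
      exact hx (by simp only [hΦz subset_rfl x h, mul_zero])).1
      ((hcu.integrableOn_compact_subset hΦU hΦc).mul_continuousOn hΦ.continuousOn hΦc)
  calc ∫ x, c x * u x * Φ x ≤ ∫ x, N * (u x * Φ x) := by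
        refine integral_mono_ae hcuΦ (huΦ.const_mul N) ?_
        filter_upwards [hcN, hu0] with x hcx hux
        by_cases hx : x ∈ U
        · rw [← mul_assoc]
          exact mul_le_mul_of_nonneg_right (mul_le_mul_of_nonneg_right (hcx hx) hux) (hΦ0 x)
        · simp [hΦz hΦU x hx]
    _ = _ := by
        simp_rw [mul_assoc, integral_const_mul]
        rw [integral_mul_eq_integral_indicator_sub_mul hS huΦ
          (hΦ.integrable_of_hasCompactSupport hΦc) (hΦz hΦS) k, mul_add]

theorem IsSupersolution.indicator_sub_const (hs0 : 0 < s) (hs1 : s < 1)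
    (hsup : IsSupersolution s b c u (openBall x₀ r))
    (hb : ContDiffOn ℝ 1 b (Metric.ball x₀ r)) (hu : MemL (2 * s) u)
    (hcu : LocallyIntegrableOn (fun x => c x * u x) (Metric.ball x₀ r)) (hu0 : ∀ᵐ x, 0 ≤ u x)
    (hcN : ∀ᵐ x, x ∈ Metric.ball x₀ r → c x ≤ N) (hm : 0 ≤ m)
    (hum : ∀ᵐ x, x ∈ Metric.ball x₀ r \ Metric.ball x₀ R₃ → m ≤ u x) (hk : 0 ≤ k)
    (hR : R₂ < R₃) (hRr : R₃ ≤ r)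
    (hkm : k * (fracConst n s * kernelTail n s (R₃ - R₂) + N) ≤
      fracConst n s * (m * volume.real (Metric.ball x₀ r \ Metric.ball x₀ R₃) /
        (2 * r) ^ ((n : ℝ) + 2 * s))) :
    IsSupersolution s b (fun _ => N) ((Metric.ball x₀ R₃).indicator fun x => u x - k)
      (openBall x₀ R₂) := by
  intro φ hφ0
  have hφ : ContDiff ℝ (⊤ : ℕ∞) φ := φ.contDiff
  have hφc := φ.hasCompactSupport
  have hφ₂ : tsupport φ ⊆ Metric.ball x₀ R₂ := φ.tsupport_subset
  have hφ₃ := hφ₂.trans (Metric.ball_subset_ball hR.le)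
  have hφr := hφ₃.trans (Metric.ball_subset_ball hRr)
  have huloc := hu.locallyIntegrable (by positivity)
  have nonlocal := integral_mul_fracLaplacian_le_integral_indicator_sub hs0 hs1
    (hφ.of_le (WithTop.coe_le_coe.2 le_top)) hφc hφ0 hφ₂ hR hRr hu hu0 hm hum hk
  have drift := integral_mul_divergence_smul_eq_integral_indicator_sub huloc
    (hφ.of_le (by exact_mod_cast le_top)) hφc Metric.isOpen_ball hb hφr
    (measurableSet_ball (x := x₀) (ε := R₃)) hφ₃ k
  have zeroth_order := integral_mul_mul_le_integral_indicator_sub huloc hu0 hcu hcN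
    hφ.continuous hφc hφ0 hφr (measurableSet_ball (x := x₀) (ε := R₃)) hφ₃ k
  have tested := hsup.nonneg_of_tsupport_subset hφ hφc hφr hφ0
  have hI : 0 ≤ ∫ x, φ x := integral_nonneg hφ0
  rw [pairing_eq_integral]
  linarith [mul_le_mul_of_nonneg_left hkm hI]

theorem fracConst_mul_kernelTail_add_le (hs0 : 0 < s) {R : ℝ} (hr : 0 < r) (hrR : r ≤ R)
    (hN : 0 ≤ N) (ρ : ℝ) :
    fracConst n s * kernelTail n s (r * ρ) + N ≤
      r ^ (-(2 * s)) * (fracConst n s * kernelTail n s ρ + N * R ^ (2 * s)) := by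
  have hRr : 1 ≤ r ^ (-(2 * s)) * R ^ (2 * s) := by
    rw [Real.rpow_neg hr.le, ← div_eq_inv_mul, one_le_div (by positivity)]
    gcongr
  rw [kernelTail_mul hr]
  linarith [mul_le_mul_of_nonneg_left hRr hN]

theorem measureReal_ball_sdiff_ball_div_rpow (x₀ : E n) (s : ℝ) {θ : ℝ} (hr : 0 < r) (hθ0 : 0 < θ)
    (hθ1 : θ ≤ 1) :
    volume.real (Metric.ball x₀ r \ Metric.ball x₀ (θ * r)) / (2 * r) ^ ((n : ℝ) + 2 * s) =
      r ^ (-(2 * s)) * ((1 - θ ^ n) * volume.real (Metric.ball (0 : E n) 1) /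
        2 ^ ((n : ℝ) + 2 * s)) := by
  rw [measureReal_ball_sdiff_ball volume x₀ hr hθ0 hθ1, finrank_euclideanSpace_fin,
    Real.mul_rpow two_pos.le hr.le, Real.rpow_add hr, Real.rpow_natCast, Real.rpow_neg hr.le]
  field_simp

theorem exists_level_mul_le (hn : 1 ≤ n) (hs0 : 0 < s) (hs1 : s < 1) {θ₂ θ₃ R : ℝ}
    (hθ0 : 0 < θ₃) (hθ1 : θ₃ < 1) (hR : 0 < R) (hN : 0 < N) :
    ∃ α : ℝ, 0 < α ∧ α ≤ 1 ∧ ∀ (x₀ : E n) (r m : ℝ), 0 < r → r ≤ R → 0 ≤ m →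
      α * m * (fracConst n s * kernelTail n s (θ₃ * r - θ₂ * r) + N) ≤
        fracConst n s * (m * volume.real (Metric.ball x₀ r \ Metric.ball x₀ (θ₃ * r)) /
          (2 * r) ^ ((n : ℝ) + 2 * s)) := by
  have hC := fracConst_pos (n := n) hs0 hs1
  have hκ := kernelTail_nonneg n s (θ₃ - θ₂)
  have hball : 0 < volume.real (Metric.ball (0 : E n) 1) :=
    ENNReal.toReal_pos (Metric.measure_ball_pos volume _ one_pos).ne' measure_ball_lt_top.ne
  have hθn : 0 < 1 - θ₃ ^ n := sub_pos.2 (pow_lt_one₀ hθ0.le hθ1 (by lia))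
  set a := (1 - θ₃ ^ n) * volume.real (Metric.ball (0 : E n) 1) / 2 ^ ((n : ℝ) + 2 * s) with ha
  set Q := fracConst n s * kernelTail n s (θ₃ - θ₂) + N * R ^ (2 * s)
  have hQ : 0 < Q := by positivity
  set α := min 1 (fracConst n s * a / Q)
  have hα : 0 < α := by positivity
  have hαQ : α * Q ≤ fracConst n s * a := (le_div_iff₀ hQ).1 (min_le_right _ _)
  refine ⟨α, hα, min_le_left _ _, fun x₀ r m hr hrR hm => ?_⟩
  rw [mul_div_assoc, measureReal_ball_sdiff_ball_div_rpow x₀ s hr hθ0 hθ1.le, ← ha, ← sub_mul,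
    mul_comm _ r]
  calc α * m * (fracConst n s * kernelTail n s (r * (θ₃ - θ₂)) + N)
      ≤ α * m * (r ^ (-(2 * s)) * Q) := by
        gcongr
        exact fracConst_mul_kernelTail_add_le hs0 hr hrR hN.le _
    _ = m * r ^ (-(2 * s)) * (α * Q) := by ring
    _ ≤ m * r ^ (-(2 * s)) * (fracConst n s * a) := by gcongr
    _ = fracConst n s * (m * (r ^ (-(2 * s)) * a)) := by ring

theorem divergence_le_of_c1Norm_le {M : ℝ} {Ω : Set (E n)} (hΩ : IsOpen Ω) (hM : 0 ≤ M)
    (hb : ContDiffOn ℝ 1 b Ω) (hbM : c1Norm b Ω ≤ ENNReal.ofReal M) {x : E n} (hx : x ∈ Ω) :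
    divergence b x ≤ n * M := by
  have hfderiv : ‖fderiv ℝ b x‖ₑ ≤ ENNReal.ofReal M :=
    (le_iSup₂ (f := fun y (_ : y ∈ Ω) => ‖fderiv ℝ b y‖ₑ) x hx).trans (le_add_self.trans hbM)
  rw [← ofReal_norm, ENNReal.ofReal_le_ofReal_iff hM] at hfderiv
  calc divergence b x ≤ n * ‖fderiv ℝ b x‖ := (le_abs_self _).trans
        (abs_divergence_le ((hb.contDiffAt (hΩ.mem_nhds hx)).differentiableAt one_ne_zero))
    _ ≤ n * M := by gcongr

theorem IsSupersolution.ae_const_le (hs0 : 0 < s) (hs1 : s < 1)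
    (hsup : IsSupersolution s b c u (openBall x₀ r))
    (hb : ContDiffOn ℝ 1 b (Metric.ball x₀ r)) {μ : ℝ} (hμ : 0 < μ)
    (hdiv : ∀ x ∈ Metric.ball x₀ r, divergence b x ≤ 2 * (N - μ)) (hu : MemL (2 * s) u)
    (hcu : LocallyIntegrableOn (fun x => c x * u x) (Metric.ball x₀ r)) (hu0 : ∀ᵐ x, 0 ≤ u x)
    (hcN : ∀ᵐ x, x ∈ Metric.ball x₀ r → c x ≤ N) {R₁ : ℝ}
    (hum : ∀ᵐ x, x ∈ Metric.ball x₀ r \ Metric.ball x₀ R₁ → m ≤ u x) (hk : 0 ≤ k) (hkm : k ≤ m)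
    (hR₁ : 0 < R₁) (hR₁₂ : R₁ < R₂) (hR₂₃ : R₂ < R₃) (hR₃ : R₃ ≤ r)
    (hlevel : k * (fracConst n s * kernelTail n s (R₃ - R₂) + N) ≤
      fracConst n s * (m * volume.real (Metric.ball x₀ r \ Metric.ball x₀ R₃) /
        (2 * r) ^ ((n : ℝ) + 2 * s))) :
    ∀ᵐ x, x ∈ Metric.ball x₀ r → k ≤ u x := by
  set v := (Metric.ball x₀ R₃).indicator fun x => u x - k
  have hv_mem {x : E n} (hx : x ∈ Metric.ball x₀ R₃) : v x = u x - k := Set.indicator_of_mem hx _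
  have hv_notMem {x : E n} (hx : x ∉ Metric.ball x₀ R₃) : v x = 0 := Set.indicator_of_notMem hx _
  have h₁₃ : Metric.ball x₀ R₁ ⊆ Metric.ball x₀ R₃ := Metric.ball_subset_ball (hR₁₂.trans hR₂₃).le
  have h₃ : Metric.ball x₀ R₃ ⊆ Metric.ball x₀ r := Metric.ball_subset_ball hR₃
  have h₂ : Metric.ball x₀ R₂ ⊆ Metric.ball x₀ r := (Metric.ball_subset_ball hR₂₃.le).trans h₃
  have hvi : Integrable v := (integrable_indicator_iff measurableSet_ball).2
    ((((hu.locallyIntegrable (by positivity)).integrableOn_isCompact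
      (isCompact_closedBall x₀ R₃)).mono_set Metric.ball_subset_closedBall).sub
        (integrableOn_const measure_ball_lt_top.ne))
  have hvk : ∀ᵐ x, -k ≤ v x := by
    filter_upwards [hu0] with x hx
    by_cases hx₃ : x ∈ Metric.ball x₀ R₃
    · linarith [hv_mem hx₃]
    · linarith [hv_notMem hx₃]
  have hv0 : ∀ᵐ x, x ∉ Metric.ball x₀ R₁ → 0 ≤ v x := by
    filter_upwards [hum] with x hx hx₁
    by_cases hx₃ : x ∈ Metric.ball x₀ R₃
    · linarith [hv_mem hx₃, hx ⟨h₃ hx₃, hx₁⟩]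
    · exact (hv_notMem hx₃).ge
  have truncated : IsSupersolution s b (fun _ => N) v (openBall x₀ R₂) :=
    hsup.indicator_sub_const hs0 hs1 hb hu hcu hu0 hcN (hk.trans hkm)
      (hum.mono fun x hx hxA => hx ⟨hxA.1, fun h => hxA.2 (h₁₃ h)⟩) hk hR₂₃ hR₃ hlevel
  filter_upwards [hum, truncated.ae_nonneg hs0 hs1 hvi hk hvk hR₁ hR₁₂ hv0 (hb.mono h₂) hμ
    fun x hx => hdiv x (h₂ hx)] with x hxm hxv hxr
  by_cases hx₃ : x ∈ Metric.ball x₀ R₃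
  · linarith [hv_mem hx₃]
  · exact hkm.trans (hxm ⟨hxr, fun h => hx₃ (h₁₃ h)⟩)

end Truncation

end FracMaxPrinciple

end

open FracMaxPrinciple in
theorem theorem1p6_general (n : ℕ) (hn : 1 ≤ n) (s : ℝ) (hs0 : 0 < s) (hs1 : s < 1)
    (θ : ℝ) (hθ0 : 0 < θ) (hθ1 : θ < 1) (R : ℝ) (hR : 0 < R) (M D : ℝ) :
    ∃ α : ℝ, 0 < α ∧
      ∀ (x₀ : E n) (r : ℝ), 0 < r → r ≤ R →
      ∀ (b : E n → E n) (c u : E n → ℝ),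
        ContDiffOn ℝ 1 b (Metric.ball x₀ r) →
        (∀ x ∈ Metric.ball x₀ r, divergence b x ≤ D) →
        (∀ᵐ x, x ∈ Metric.ball x₀ r → c x ≤ M) →
        MemL (2 * s) u →
        LocallyIntegrableOn (fun x => c x * u x) (Metric.ball x₀ r) →
        (∀ᵐ x, 0 ≤ u x) →
        IsSupersolution s b c u (openBall x₀ r) →
        ∀ m : ℝ, 0 ≤ m →
        (∀ᵐ x, x ∈ Metric.ball x₀ r \ Metric.ball x₀ (θ * r) → m ≤ u x) →
        ∀ᵐ x, x ∈ Metric.ball x₀ r → α * m ≤ u x := by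
  obtain ⟨θ₃, hθθ₃, hθ₃1⟩ := exists_between hθ1
  obtain ⟨θ₂, hθθ₂, hθ₂θ₃⟩ := exists_between hθθ₃
  have hN : 0 < |M| + |D| + 1 := by positivity
  obtain ⟨α, hα0, hα1, hα⟩ := exists_level_mul_le (θ₂ := θ₂) hn hs0 hs1 (hθ0.trans hθθ₃) hθ₃1 hR hN
  refine ⟨α, hα0, fun x₀ r hr hrR b c u hb hbD hcM hu hcu hu0 hsup m hm hum => ?_⟩
  exact hsup.ae_const_le (R₂ := θ₂ * r) (R₃ := θ₃ * r) hs0 hs1 hb one_pos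
    (fun x hx => (hbD x hx).trans (by linarith [abs_nonneg M, le_abs_self D, abs_nonneg D]))
    hu hcu hu0
    (hcM.mono fun x hx hxr => (hx hxr).trans (by linarith [le_abs_self M, abs_nonneg D]))
    hum (mul_nonneg hα0.le hm) (mul_le_of_le_one_left hm hα1) (by positivity) (by gcongr)
    (by gcongr) (mul_le_of_le_one_left hr.le hθ₃1.le) (hα x₀ r m hr hrR hm)

theorem theorem1p6 (n : ℕ) (hn : 2 ≤ n) (s : ℝ) (hs0 : 0 < s) (hs1 : s < 1)
    (M : ℝ) (hM : 0 < M) :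
    ∃ α : ℝ, 0 < α ∧
      ∀ (x₀ : FracMaxPrinciple.E n) (r : ℝ), 0 < r → r ≤ 1 →
      ∀ (b : FracMaxPrinciple.E n → FracMaxPrinciple.E n) (c u : FracMaxPrinciple.E n → ℝ),
        ContDiffOn ℝ 1 b (Metric.ball x₀ r) →
        FracMaxPrinciple.c1Norm b (Metric.ball x₀ r) ≤ ENNReal.ofReal M →
        (∀ᵐ x, x ∈ Metric.ball x₀ r → c x ≤ M) →
        FracMaxPrinciple.MemL (2 * s) u →
        -- `c u` is locally integrable, so that it is a distribution on the ball
        LocallyIntegrableOn (fun x => c x * u x) (Metric.ball x₀ r) →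
        (∀ᵐ x, 0 ≤ u x) →
        FracMaxPrinciple.IsSupersolution s b c u (FracMaxPrinciple.openBall x₀ r) →
        ∀ m : ℝ, 0 < m →
        (∀ᵐ x, x ∈ Metric.ball x₀ r \ Metric.ball x₀ (r / 2) → m ≤ u x) →
        ∀ᵐ x, x ∈ Metric.ball x₀ r → α * m ≤ u x := by
  obtain ⟨α, hα0, hα⟩ := theorem1p6_general n (by lia) s hs0 hs1 2⁻¹ (by norm_num) (by norm_num)
    1 one_pos M (n * M)
  exact ⟨α, hα0, fun x₀ r hr hr1 b c u hb hbM hc hu hcu hu0 hsup m hm hum =>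
    hα x₀ r hr hr1 b c u hb
      (fun _ => FracMaxPrinciple.divergence_le_of_c1Norm_le Metric.isOpen_ball hM.le hb hbM)
      hc hu hcu hu0 hsup m hm.le (by simpa only [div_eq_inv_mul] using hum)⟩
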